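/- Let $n\ge 2$. For $s\in(0,1)$ and a Lebesgue measurable set $E\subset\mathbb R^n$ let $$P_s(E)=\int_E\int_{E^c}\frac{dx\,dy}{|x-y|^{n+s}}\in[0,\infty]$$ be the $s$-perimeter, let $P(E)=\sup\{\int_E \operatorname{div}X\,dx : X\in C^1_c(\mathbb R^n;\mathbb R^n),\ |X|\le 1\}$ be the (distributional) perimeter, let $|E|$ be the Lebesgue measure, and let $B_r=\{x\in\mathbb R^n:|x|<r\}$, $B=B_1$. For $s\in(0,1)$ set $$C_1(n,s)=2^{1+\frac{n-s}{s}}\Big(\frac{4\,|B|^{(n-s)/n}\,P(B)}{s\,(1-s)\,P_s(B)}\Big)^{1/s},\qquad C_2(n,s)=\frac{2\,|B|^{(n-s)/n}}{(1-s)\,P_s(B)}.$$ Then: (i) For every $s\in(0,1)$ the constants $C_1(n,s)$ and $C_2(n,s)$ are positive real numbers, and whenever $E\subset\mathbb R^n$ is Lebesgue measurable and $\eta\in[0,1)$ satisfies $|E\setminus B|\le\eta$, there exists $r_E$ with $1\le r_E\le 1+C_1(n,s)\,\eta^{1/n}$ such that $$(1-s)\,P_s(E\cap B_{r_E})\le(1-s)\,P_s(E)-\frac{|E\setminus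 B_{r_E}|}{C_2(n,s)\,\eta^{s/n}},$$ where the last term is read as $0$ if $\eta=0$ (in which case $r_E=1$ and $|E\setminus B_{r_E}|=0$), and the inequality is trivially true if $P_s(E)=\infty$. (ii) For every $s_0\in(0,1)$, $\ \sup\{C_1(n,s)+C_2(n,s): s_0\le s<1\}<\infty$. -/

import Mathlib

open MeasureTheory Set

noncomputable section

namespace FracPerimeter

/-- The `s`-perimeter `P_s(E) = ∫_E ∫_{Eᶜ} dx dy / |x - y|^(n+s)`, an element of `[0, ∞]`. The
kernel is only evaluated at `x ∈ E`, `y ∉ E`, hence never on the diagonal. -/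
def fracPerimeter {n : ℕ} (s : ℝ) (E : Set (EuclideanSpace ℝ (Fin n))) : ENNReal :=
  ∫⁻ x in E, ∫⁻ y in Eᶜ, ENNReal.ofReal (1 / ‖x - y‖ ^ ((n : ℝ) + s))

/-- The divergence `∑ i, ∂ᵢ Xᵢ` of a vector field on `ℝⁿ`. -/
def divergence {n : ℕ} (X : EuclideanSpace ℝ (Fin n) → EuclideanSpace ℝ (Fin n))
    (x : EuclideanSpace ℝ (Fin n)) : ℝ :=
  ∑ i : Fin n, (fderiv ℝ X x (EuclideanSpace.single i (1 : ℝ))) i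

/-- The distributional perimeter `P(E)`: the supremum of `∫_E div X` over all compactly supported
`C¹` vector fields `X` with `|X| ≤ 1`. (As `X = 0` is allowed, the supremum is nonnegative, so that
truncating the integrals at `0` does not change it.) -/
def perimeter {n : ℕ} (E : Set (EuclideanSpace ℝ (Fin n))) : ENNReal :=
  ⨆ (X : EuclideanSpace ℝ (Fin n) → EuclideanSpace ℝ (Fin n)) (_ : ContDiff ℝ 1 X)
    (_ : HasCompactSupport X) (_ : ∀ x, ‖X x‖ ≤ 1), ENNReal.ofReal (∫ x in E, divergence X x)

/-- The open ball `B_r` of radius `r` centred at the origin of `ℝⁿ`. -/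
def oball (n : ℕ) (r : ℝ) : Set (EuclideanSpace ℝ (Fin n)) := {x | ‖x‖ < r}

/-- `|B|`, the Lebesgue measure of the unit ball. -/
def ballVolume (n : ℕ) : ℝ := (volume (oball n 1)).toReal

/-- `P(B)`, the perimeter of the unit ball. -/
def ballPerimeter (n : ℕ) : ℝ := (perimeter (oball n 1)).toReal

/-- `P_s(B)`, the `s`-perimeter of the unit ball. -/
def ballFracPerimeter (n : ℕ) (s : ℝ) : ℝ := (fracPerimeter s (oball n 1)).toReal

/-- `C₁(n,s) = 2^(1+(n-s)/s) (4 |B|^((n-s)/n) P(B) / (s (1-s) P_s(B)))^(1/s)`. -/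
def C₁ (n : ℕ) (s : ℝ) : ℝ :=
  (2 : ℝ) ^ (1 + ((n : ℝ) - s) / s) *
    (4 * ballVolume n ^ (((n : ℝ) - s) / (n : ℝ)) * ballPerimeter n /
      (s * (1 - s) * ballFracPerimeter n s)) ^ (1 / s)

/-- `C₂(n,s) = 2 |B|^((n-s)/n) / ((1-s) P_s(B))`. -/
def C₂ (n : ℕ) (s : ℝ) : ℝ :=
  2 * ballVolume n ^ (((n : ℝ) - s) / (n : ℝ)) / ((1 - s) * ballFracPerimeter n s)

end FracPerimeter

end

/-! Write w(r) = |E \ B_r|, α = (n-s)/n, and let I(r) be the interaction of E \ B_r with E ∩ B_r.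
Splitting E gives P_s(E ∩ B_r) + P_s(E \ B_r) = P_s(E) + 2 I(r), and the fractional isoperimetric
inequality bounds P_s(E \ B_r) below by c w(r)^α with c = P_s(B) / |B|^α. Suppose the claimed
inequality fails for every r in [1, 1 + L], where L = C₁ η^(1/n). Since w ≤ η, the constant C₂ is
exactly such that the penalty term uses up at most half of the isoperimetric gain, so (c/2) w(r)^α ≤
2 I(r) (`ofReal_le_interaction_of_lt`).

A point x outside B_r lies at distance at least |x| - r from E ∩ B_r, hence I(r) ≤ (n|B|/s) ∫_{E \
B_r} (|x| - r)^(-s) dx. Integrating over r in (a, b) makes the singularity harmless because s < 1,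
and yields w(b)^α ≤ D (b - a)^(-s) w(a) with D = `decayConstant n s` (`decay_of_not_truncation`). As
α < 1, a De Giorgi iteration along radii increasing to 1 + L forces w(1 + L) = 0
(`eq_zero_of_decay`). But then cutting at 1 + L costs nothing, a contradiction.

The isoperimetric inequality (`interaction_ball_compl_le_of_forall_lt`) is obtained by polarization.
Reflecting in a hyperplane and moving mass towards the side of the origin keeps the volume and does
not increase the energy. Averaging over hyperplanes shows that, as long as a set differs from the
ball by a definite amount, some polarization brings it closer by a definite amount. So the infimal
discrepancy is zero, and energies with integrable kernels are continuous in measure; general kernels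
follow by monotone truncation.

The perimeter of B enters only through n|B| ≤ P(B) < ∞. Uniformity in s comes from a lower bound on
(1-s) P_s(B) that is independent of s (`le_fracPerimeter_ball_one`). -/

namespace FracPerimeter

open scoped ENNReal

noncomputable section

section

variable {V : Type*} [NormedAddCommGroup V] [InnerProductSpace ℝ V] [FiniteDimensional ℝ V]
  [MeasurableSpace V] [BorelSpace V]

/-! ### Interaction energies -/

/-- The interaction energy `∫_A ∫_B k(|x - y|) dx dy` of two sets. -/
def interaction (k : ℝ → ℝ≥0∞) (A B : Set V) : ℝ≥0∞ :=
  ∫⁻ x in A, ∫⁻ y in B, k ‖x - y‖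

lemma interaction_congr_set (k : ℝ → ℝ≥0∞) {A A' B B' : Set V} (hA : A =ᵐ[volume] A')
    (hB : B =ᵐ[volume] B') : interaction k A B = interaction k A' B' := by
  simp only [interaction, Measure.restrict_congr_set hA, Measure.restrict_congr_set hB]

lemma measurable_norm_sub_kernel {k : ℝ → ℝ≥0∞} (hk : Measurable k) :
    Measurable fun p : V × V => k ‖p.1 - p.2‖ :=
  hk.comp (measurable_fst.sub measurable_snd).norm

lemma interaction_comm {k : ℝ → ℝ≥0∞} (hk : Measurable k) (A B : Set V) :
    interaction k A B = interaction k B A := by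
  unfold interaction
  rw [lintegral_lintegral_swap (measurable_norm_sub_kernel hk).aemeasurable]
  simp only [norm_sub_rev]

lemma interaction_mono (k : ℝ → ℝ≥0∞) {A A' B B' : Set V} (hA : A ⊆ A') (hB : B ⊆ B') :
    interaction k A B ≤ interaction k A' B' :=
  (lintegral_mono_set hA).trans (lintegral_mono fun _ => lintegral_mono_set hB)

lemma interaction_union_left (k : ℝ → ℝ≥0∞) {A A' : Set V} (B : Set V) (hA' : MeasurableSet A')
    (hd : Disjoint A A') :
    interaction k (A ∪ A') B = interaction k A B + interaction k A' B :=
  lintegral_union hA' hd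

lemma interaction_union_right {k : ℝ → ℝ≥0∞} (hk : Measurable k) {A A' : Set V} (B : Set V)
    (hA' : MeasurableSet A') (hd : Disjoint A A') :
    interaction k B (A ∪ A') = interaction k B A + interaction k B A' := by
  rw [interaction_comm hk, interaction_union_left k B hA' hd, interaction_comm hk A,
    interaction_comm hk A']

lemma interaction_union_le_left (k : ℝ → ℝ≥0∞) (A A' B : Set V) :
    interaction k (A ∪ A') B ≤ interaction k A B + interaction k A' B :=
  lintegral_union_le _ _ _

lemma interaction_le_volume_mul (k : ℝ → ℝ≥0∞) (A B : Set V) :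
    interaction k A B ≤ (∫⁻ y : V, k ‖y‖) * volume A := by
  calc interaction k A B ≤ ∫⁻ _ in A, ∫⁻ y : V, k ‖y‖ := by
        refine lintegral_mono fun x => (setLIntegral_le_lintegral _ _).trans_eq ?_
        rw [← lintegral_sub_left_eq_self (fun y => k ‖y‖) x]
    _ = _ := by rw [lintegral_const]; simp

/-- Exchanging the sets one slot at a time costs at most the kernel mass times the volume exchanged.
For a kernel of finite mass the energy is thus continuous in measure. -/
lemma interaction_compl_le {k : ℝ → ℝ≥0∞} (hk : Measurable k) (A B : Set V) :
    interaction k B Bᶜ ≤ interaction k A Aᶜ +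
      (∫⁻ y : V, k ‖y‖) * (volume (A \ B) + volume (B \ A)) := by
  have h1 : interaction k B Bᶜ ≤ interaction k A Bᶜ + interaction k (B \ A) Bᶜ :=
    (interaction_mono k (by rw [union_sdiff_self]; exact subset_union_right) subset_rfl).trans
      (interaction_union_le_left k A (B \ A) Bᶜ)
  have h2 : interaction k A Bᶜ ≤ interaction k A Aᶜ + interaction k (A \ B) A := by
    rw [interaction_comm hk A Bᶜ, interaction_comm hk A Aᶜ]
    refine (interaction_mono k (A' := Aᶜ ∪ (A \ B)) ?_ subset_rfl).trans
      (interaction_union_le_left k _ _ _)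
    intro x hx
    by_cases hA : x ∈ A
    · exact Or.inr ⟨hA, hx⟩
    · exact Or.inl hA
  calc _ ≤ _ := h1
    _ ≤ (interaction k A Aᶜ + interaction k (A \ B) A) + interaction k (B \ A) Bᶜ := by gcongr
    _ ≤ (interaction k A Aᶜ + (∫⁻ y : V, k ‖y‖) * volume (A \ B)) +
        (∫⁻ y : V, k ‖y‖) * volume (B \ A) := by
      gcongr <;> exact interaction_le_volume_mul _ _ _
    _ = _ := by ring

/-- Splitting a set in two pieces changes the energy by twice their mutual interaction. -/
lemma interaction_compl_inter_add_diff {k : ℝ → ℝ≥0∞} (hk : Measurable k) {A B : Set V}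
    (hA : MeasurableSet A) (hB : MeasurableSet B) :
    interaction k (A ∩ B) (A ∩ B)ᶜ + interaction k (A \ B) (A \ B)ᶜ =
      interaction k A Aᶜ + 2 * interaction k (A \ B) (A ∩ B) := by
  -- The complement of each piece is `Aᶜ` plus the other piece, so the mutual term is counted once
  -- from each side.
  have e1 : (A ∩ B)ᶜ = Aᶜ ∪ A \ B := by ext x; simp; tauto
  have e2 : (A \ B)ᶜ = Aᶜ ∪ A ∩ B := by ext x; simp; tauto
  have e3 : interaction k A Aᶜ = interaction k (A ∩ B) Aᶜ + interaction k (A \ B) Aᶜ := by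
    conv_lhs => enter [2]; rw [← inter_union_sdiff A B]
    exact interaction_union_left k _ (hA.diff hB) disjoint_inf_sdiff
  rw [e1, e2, interaction_union_right hk _ (hA.diff hB), interaction_union_right hk _ (hA.inter hB),
    e3, interaction_comm hk (A ∩ B) (A \ B)]
  · ring
  · exact disjoint_left.2 fun x hx hx' => hx hx'.1
  · exact disjoint_left.2 fun x hx hx' => hx hx'.1

end

section

/-! ### Polarization with respect to an abstract reflection -/

/-- The polarization (two-point rearrangement) of `E` under the involution `σ`, moving `E` into
`H`. -/
def polarize {X : Type*} (σ : X → X) (H E : Set X) : Set X :=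
  {x | (x ∈ H ∧ (x ∈ E ∨ σ x ∈ E)) ∨ (x ∉ H ∧ x ∈ E ∧ σ x ∈ E)}

section Abstract

variable {X : Type*} [MeasurableSpace X] {μ : Measure X} {σ : X → X} {H : Set X}

lemma measurableSet_polarize (hσ : Measurable σ) (hH : MeasurableSet H) {E : Set X}
    (hE : MeasurableSet E) : MeasurableSet (polarize σ H E) :=
  (hH.inter (hE.union (hσ hE))).union (hH.compl.inter (hE.inter (hσ hE)))

lemma lintegral_add_comp_involution (hσ : MeasurePreserving σ μ μ) {f : X → ℝ≥0∞}
    (hf : Measurable f) : ∫⁻ x, (f x + f (σ x)) ∂μ = 2 * ∫⁻ x, f x ∂μ := by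
  rw [lintegral_add_left hf, hσ.lintegral_comp hf, two_mul]

/-- A function and its reflection have the same integral, so integrals can be compared orbit by
orbit. This turns every polarization estimate into a finite case check. -/
lemma lintegral_le_of_add_comp_le (hσ : MeasurePreserving σ μ μ) {f g : X → ℝ≥0∞}
    (hf : Measurable f) (hg : Measurable g) (h : ∀ x, f x + f (σ x) ≤ g x + g (σ x)) :
    ∫⁻ x, f x ∂μ ≤ ∫⁻ x, g x ∂μ := by
  have := lintegral_mono (μ := μ) h
  rw [lintegral_add_comp_involution hσ hf, lintegral_add_comp_involution hσ hg] at this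
  exact (ENNReal.mul_le_mul_iff_right two_ne_zero (by simp)).1 this

/-- Polarization moves mass into every set that prefers `H`, with a quantified gain. -/
lemma measure_polarize_diff_add_le (hσ : MeasurePreserving σ μ μ) (hinv : ∀ x, σ (σ x) = x)
    (hH : MeasurableSet H) (hcov : ∀ x, x ∈ H ∨ σ x ∈ H) (hfix : ∀ x ∈ H, σ x ∈ H → σ x = x)
    {E B : Set X} (hE : MeasurableSet E) (hB : MeasurableSet B)
    (hBH : ∀ x ∈ H, σ x ∈ B → x ∈ B) :
    μ (polarize σ H E \ B) + μ {x | x ∉ H ∧ x ∈ E \ B ∧ σ x ∈ B \ E} ≤ μ (E \ B) := by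
  classical
  have mP := (measurableSet_polarize hσ.measurable hH hE).diff hB
  have mG : MeasurableSet {x | x ∉ H ∧ x ∈ E \ B ∧ σ x ∈ B \ E} :=
    hH.compl.inter ((hE.diff hB).inter (hσ.measurable (hB.diff hE)))
  have one : ∀ {s : Set X}, MeasurableSet s → Measurable (s.indicator (1 : X → ℝ≥0∞)) :=
    fun hs => measurable_one.indicator hs
  rw [← lintegral_indicator_one mP, ← lintegral_indicator_one mG,
    ← lintegral_indicator_one (hE.diff hB), ← lintegral_add_left (one mP)]
  refine lintegral_le_of_add_comp_le hσ ((one mP).add (one mG)) (one (hE.diff hB)) fun x => ?_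
  have key : ∀ x ∈ H,
      (polarize σ H E \ B).indicator (1 : X → ℝ≥0∞) x +
        {x | x ∉ H ∧ x ∈ E \ B ∧ σ x ∈ B \ E}.indicator (1 : X → ℝ≥0∞) x +
        ((polarize σ H E \ B).indicator (1 : X → ℝ≥0∞) (σ x) +
        {x | x ∉ H ∧ x ∈ E \ B ∧ σ x ∈ B \ E}.indicator (1 : X → ℝ≥0∞) (σ x)) ≤
      (E \ B).indicator (1 : X → ℝ≥0∞) x + (E \ B).indicator (1 : X → ℝ≥0∞) (σ x) := by
    intro x hx
    by_cases hx' : σ x ∈ H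
    · have hxx := hfix x hx hx'
      by_cases h1 : x ∈ E <;> by_cases h2 : x ∈ B <;>
        simp [indicator, polarize, hxx, hx, h1, h2]
    · by_cases h1 : x ∈ E <;> by_cases h2 : x ∈ B <;> by_cases h3 : σ x ∈ E <;>
        by_cases h4 : σ x ∈ B <;>
        -- The one configuration that would break the estimate, `x ∉ B` with `σ x ∈ B`, is excluded
        -- by `hBH`.
        first
          | exact absurd (hBH x hx h4) h2
          | simp [indicator, polarize, hinv, hx, hx', h1, h2, h3, h4]
  rcases hcov x with hx | hx
  · exact key x hx
  · have := key (σ x) hx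
    rw [hinv x] at this
    rw [add_comm (E \ B |>.indicator _ x)]
    refine le_trans (le_of_eq ?_) this
    rw [add_comm]

lemma measure_polarize (hσ : MeasurePreserving σ μ μ) (hinv : ∀ x, σ (σ x) = x)
    (hH : MeasurableSet H) (hcov : ∀ x, x ∈ H ∨ σ x ∈ H) (hfix : ∀ x ∈ H, σ x ∈ H → σ x = x)
    {E : Set X} (hE : MeasurableSet E) : μ (polarize σ H E) = μ E := by
  classical
  have mP := measurableSet_polarize hσ.measurable hH hE
  have one : ∀ {s : Set X}, MeasurableSet s → Measurable (s.indicator (1 : X → ℝ≥0∞)) :=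
    fun hs => measurable_one.indicator hs
  have key : ∀ x ∈ H, (polarize σ H E).indicator (1 : X → ℝ≥0∞) x +
      (polarize σ H E).indicator (1 : X → ℝ≥0∞) (σ x) =
      E.indicator (1 : X → ℝ≥0∞) x + E.indicator (1 : X → ℝ≥0∞) (σ x) := by
    intro x hx
    by_cases hx' : σ x ∈ H
    · have hxx := hfix x hx hx'
      by_cases h1 : x ∈ E <;> simp [indicator, polarize, hxx, hx, h1]
    · by_cases h1 : x ∈ E <;> by_cases h3 : σ x ∈ E <;>
        simp [indicator, polarize, hinv, hx, hx', h1, h3]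
  have key' : ∀ x, (polarize σ H E).indicator (1 : X → ℝ≥0∞) x +
      (polarize σ H E).indicator (1 : X → ℝ≥0∞) (σ x) =
      E.indicator (1 : X → ℝ≥0∞) x + E.indicator (1 : X → ℝ≥0∞) (σ x) := by
    intro x
    rcases hcov x with hx | hx
    · exact key x hx
    · have := key (σ x) hx
      rwa [hinv x, add_comm, add_comm (E.indicator _ (σ x))] at this
  rw [← lintegral_indicator_one mP, ← lintegral_indicator_one hE]
  exact le_antisymm
    (lintegral_le_of_add_comp_le hσ (one mP) (one hE) fun x => (key' x).le)
    (lintegral_le_of_add_comp_le hσ (one hE) (one mP) fun x => (key' x).ge)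

/-- The two-point inequality: polarization decreases the energy of a set against its
complement. -/
lemma lintegral_polarize_compl_le [SFinite μ] (hσ : MeasurePreserving σ μ μ)
    (hinv : ∀ x, σ (σ x) = x)
    (hH : MeasurableSet H) (hcov : ∀ x, x ∈ H ∨ σ x ∈ H) (hfix : ∀ x ∈ H, σ x ∈ H → σ x = x)
    {K : X → X → ℝ≥0∞} (hK : Measurable fun p : X × X => K p.1 p.2)
    (hKσ : ∀ x y, K (σ x) (σ y) = K x y)
    (hKH : ∀ x ∈ H, ∀ y ∈ H, K (σ x) y ≤ K x y) {E : Set X} (hE : MeasurableSet E) :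
    ∫⁻ x in polarize σ H E, ∫⁻ y in (polarize σ H E)ᶜ, K x y ∂μ ∂μ ≤
      ∫⁻ x in E, ∫⁻ y in Eᶜ, K x y ∂μ ∂μ := by
  classical
  have mP := measurableSet_polarize hσ.measurable hH hE
  have hKσ' : ∀ x y, K x (σ y) = K (σ x) y := fun x y => by
    rw [← hKσ x (σ y), hinv]
  -- the integrand, summed over the four reflections of a pair of points
  let F : Set X → X → X → ℝ≥0∞ := fun A x y => if x ∈ A ∧ y ∉ A then K x y else 0
  have hF : ∀ A : Set X, MeasurableSet A → Measurable fun p : X × X => F A p.1 p.2 :=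
    fun A hA => Measurable.ite ((measurable_fst hA).inter (measurable_snd hA).compl) hK
      measurable_const
  have hFy : ∀ A : Set X, MeasurableSet A → ∀ x, Measurable (F A x) :=
    fun A hA x => (hF A hA).comp measurable_prodMk_left
  have hI : ∀ A : Set X, MeasurableSet A →
      ∫⁻ x in A, ∫⁻ y in Aᶜ, K x y ∂μ ∂μ = ∫⁻ x, ∫⁻ y, F A x y ∂μ ∂μ := by
    intro A hA
    rw [← lintegral_indicator hA]
    refine lintegral_congr fun x => ?_
    by_cases hx : x ∈ A
    · rw [indicator_of_mem hx, ← lintegral_indicator hA.compl]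
      refine lintegral_congr fun y => ?_
      by_cases hy : y ∈ A <;> simp [F, hx, hy]
    · simp [F, hx]
  have key : ∀ x ∈ H, ∀ y ∈ H,
      (F (polarize σ H E) x y + F (polarize σ H E) x (σ y)) +
        (F (polarize σ H E) (σ x) y + F (polarize σ H E) (σ x) (σ y)) ≤
      (F E x y + F E x (σ y)) + (F E (σ x) y + F E (σ x) (σ y)) := by
    intro x hx y hy
    have h := hKH x hx y hy
    by_cases hx' : σ x ∈ H
    · have hxx := hfix x hx hx'
      by_cases hy' : σ y ∈ H
      · have hyy := hfix y hy hy'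
        by_cases h1 : x ∈ E <;> by_cases h2 : y ∈ E <;>
          simp [F, polarize, hxx, hyy, hx, hy, h1, h2]
      · have e := hKσ' x y
        rw [hxx] at e
        by_cases h1 : x ∈ E <;> by_cases h2 : y ∈ E <;> by_cases h3 : σ y ∈ E <;>
          simp [F, polarize, hxx, hinv, hx, hy, hy', h1, h2, h3, e]
    · by_cases hy' : σ y ∈ H
      · have hyy := hfix y hy hy'
        have e := hKσ' x y
        rw [hyy] at e
        by_cases h1 : x ∈ E <;> by_cases h2 : y ∈ E <;> by_cases h3 : σ x ∈ E <;>
          simp [F, polarize, hyy, hinv, hx, hy, hx', h1, h2, h3, ← e]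
      -- The case that uses `h`: `E` contains exactly one of `x`, `σ x` and exactly one of `y`, `σ
      -- y`, on opposite sides. Polarization puts both on the same side and replaces `K x y` by `K
      -- (σ x) y`.
      · by_cases h1 : x ∈ E <;> by_cases h2 : y ∈ E <;> by_cases h3 : σ x ∈ E <;>
          by_cases h4 : σ y ∈ E <;>
          simp [F, polarize, hinv, hx, hy, hx', hy', h1, h2, h3, h4, hKσ, hKσ', h, add_comm]
  have key' : ∀ x, ∀ y,
      (F (polarize σ H E) x y + F (polarize σ H E) x (σ y)) +
        (F (polarize σ H E) (σ x) y + F (polarize σ H E) (σ x) (σ y)) ≤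
      (F E x y + F E x (σ y)) + (F E (σ x) y + F E (σ x) (σ y)) := by
    intro x y
    have hx : ∃ a ∈ H, (a = x ∧ σ a = σ x) ∨ (a = σ x ∧ σ a = x) := by
      rcases hcov x with h | h
      exacts [⟨x, h, .inl ⟨rfl, rfl⟩⟩, ⟨σ x, h, .inr ⟨rfl, hinv x⟩⟩]
    have hy : ∃ b ∈ H, (b = y ∧ σ b = σ y) ∨ (b = σ y ∧ σ b = y) := by
      rcases hcov y with h | h
      exacts [⟨y, h, .inl ⟨rfl, rfl⟩⟩, ⟨σ y, h, .inr ⟨rfl, hinv y⟩⟩]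
    obtain ⟨a, ha, ha'⟩ := hx
    obtain ⟨b, hb, hb'⟩ := hy
    have := key a ha b hb
    -- The sum over the four reflected pairs does not depend on the representatives of the two
    -- orbits.
    have swap : ∀ G : X → X → ℝ≥0∞, (G a b + G a (σ b)) + (G (σ a) b + G (σ a) (σ b)) =
        (G x y + G x (σ y)) + (G (σ x) y + G (σ x) (σ y)) := by
      intro G
      rcases ha' with ⟨e1, e2⟩ | ⟨e1, e2⟩ <;> rcases hb' with ⟨e3, e4⟩ | ⟨e3, e4⟩ <;>
        rw [e2, e4, e1, e3] <;> ring
    rwa [swap (F (polarize σ H E)), swap (F E)] at this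
  rw [hI _ mP, hI _ hE]
  have mI : ∀ A : Set X, MeasurableSet A → Measurable fun x => ∫⁻ y, F A x y ∂μ :=
    fun A hA => (hF A hA).lintegral_prod_right'
  refine lintegral_le_of_add_comp_le hσ (mI _ mP) (mI _ hE) fun x => ?_
  rw [← lintegral_add_left (hFy _ mP x), ← lintegral_add_left (hFy _ hE x)]
  refine lintegral_le_of_add_comp_le hσ ((hFy _ mP x).add (hFy _ mP (σ x)))
    ((hFy _ hE x).add (hFy _ hE (σ x))) fun y => ?_
  refine le_trans (le_of_eq ?_) ((key' x y).trans (le_of_eq ?_)) <;> ring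

end Abstract

end

section

variable {V : Type*} [NormedAddCommGroup V] [InnerProductSpace ℝ V]

/-! ### Reflections in affine hyperplanes -/

/-- The reflection in the hyperplane `{x | ⟪v, x⟫ = t}`. -/
def hyperplaneReflection (v : V) (t : ℝ) (x : V) : V :=
  x - (2 * (inner ℝ v x - t) / ‖v‖ ^ 2) • v

lemma inner_hyperplaneReflection {v : V} (hv : v ≠ 0) (t : ℝ) (x : V) :
    inner ℝ v (hyperplaneReflection v t x) = 2 * t - inner ℝ v x := by
  have : ‖v‖ ≠ 0 := norm_ne_zero_iff.2 hv
  rw [hyperplaneReflection, inner_sub_right, inner_smul_right, real_inner_self_eq_norm_sq]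
  field_simp
  ring

lemma hyperplaneReflection_involutive {v : V} (hv : v ≠ 0) (t : ℝ) (x : V) :
    hyperplaneReflection v t (hyperplaneReflection v t x) = x := by
  conv_lhs => rw [hyperplaneReflection, inner_hyperplaneReflection hv, hyperplaneReflection]
  rw [sub_sub, ← add_smul]
  convert sub_zero x
  rw [show 2 * (inner ℝ v x - t) / ‖v‖ ^ 2 + 2 * (2 * t - inner ℝ v x - t) / ‖v‖ ^ 2 = 0 by ring,
    zero_smul]

lemma norm_sq_hyperplaneReflection_sub {v : V} (hv : v ≠ 0) (t : ℝ) (x y : V) :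
    ‖hyperplaneReflection v t x - y‖ ^ 2 =
      ‖x - y‖ ^ 2 + 4 * (t - inner ℝ v x) * (t - inner ℝ v y) / ‖v‖ ^ 2 := by
  have : ‖v‖ ≠ 0 := norm_ne_zero_iff.2 hv
  rw [hyperplaneReflection, sub_right_comm, norm_sub_sq_real, inner_smul_right, norm_smul,
    real_inner_comm v (x - y), inner_sub_right, mul_pow, Real.norm_eq_abs, sq_abs]
  field_simp
  ring

/-- Two points on one side of a mirror are no farther apart than one of them and the image of the
other. This supplies the kernel hypothesis of polarization and, with `y = 0`, the preference of
centred balls for the half space. -/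
lemma norm_sub_le_norm_hyperplaneReflection_sub {v : V} (hv : v ≠ 0) {t : ℝ} {x y : V}
    (hx : inner ℝ v x ≤ t) (hy : inner ℝ v y ≤ t) :
    ‖x - y‖ ≤ ‖hyperplaneReflection v t x - y‖ := by
  refine le_of_sq_le_sq ?_ (norm_nonneg _)
  rw [norm_sq_hyperplaneReflection_sub hv]
  have : 0 ≤ 4 * (t - inner ℝ v x) * (t - inner ℝ v y) / ‖v‖ ^ 2 := by
    have := sub_nonneg.2 hx
    have := sub_nonneg.2 hy
    positivity
  linarith

/-- A linear reflection followed by a translation: isometry and preservation of volume are inherited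
from these two factors. -/
lemma hyperplaneReflection_eq_reflection (v : V) (t : ℝ) (x : V) :
    hyperplaneReflection v t x =
      (Submodule.span ℝ {v})ᗮ.reflection x + (2 * t / ‖v‖ ^ 2) • v := by
  rw [Submodule.reflection_orthogonal_apply, Submodule.reflection_singleton_apply,
    hyperplaneReflection, neg_sub, sub_add, ← Nat.cast_smul_eq_nsmul ℝ, smul_smul, ← sub_smul]
  congr 2
  push_cast
  simp only [RCLike.ofReal_real_eq_id, id]
  ring

lemma norm_hyperplaneReflection_sub (v : V) (t : ℝ) (x y : V) :
    ‖hyperplaneReflection v t x - hyperplaneReflection v t y‖ = ‖x - y‖ := by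
  rw [hyperplaneReflection_eq_reflection, hyperplaneReflection_eq_reflection,
    add_sub_add_right_eq_sub, ← map_sub, LinearIsometryEquiv.norm_map]

lemma halfSpace_cover {v : V} (hv : v ≠ 0) (t : ℝ) (x : V) :
    x ∈ {x : V | inner ℝ v x ≤ t} ∨ hyperplaneReflection v t x ∈ {x : V | inner ℝ v x ≤ t} := by
  simp only [mem_ofPred_eq, inner_hyperplaneReflection hv]
  rcases le_total (inner ℝ v x) t with h | h
  · exact .inl h
  · right; linarith

lemma hyperplaneReflection_eq_self {v : V} (hv : v ≠ 0) (t : ℝ) :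
    ∀ x ∈ {x : V | inner ℝ v x ≤ t}, hyperplaneReflection v t x ∈ {x : V | inner ℝ v x ≤ t} →
      hyperplaneReflection v t x = x := by
  intro x hx hx'
  simp only [mem_ofPred_eq, inner_hyperplaneReflection hv] at hx hx'
  have : inner ℝ v x = t := by linarith
  simp [hyperplaneReflection, this]

section Measure

variable [FiniteDimensional ℝ V] [MeasurableSpace V] [BorelSpace V]

lemma measurePreserving_hyperplaneReflection (v : V) (t : ℝ) :
    MeasurePreserving (hyperplaneReflection v t) := by
  have := (measurePreserving_add_right volume ((2 * t / ‖v‖ ^ 2) • v)).comp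
    ((Submodule.span ℝ {v})ᗮ.reflection).measurePreserving
  rwa [show hyperplaneReflection v t = _ from funext (hyperplaneReflection_eq_reflection v t)]

/-- Polarization in the half space `{x | ⟪v, x⟫ ≤ t}`. -/
def halfSpacePolarize (v : V) (t : ℝ) (E : Set V) : Set V :=
  polarize (hyperplaneReflection v t) {x | inner ℝ v x ≤ t} E

omit [FiniteDimensional ℝ V] in
lemma measurableSet_halfSpace (v : V) (t : ℝ) : MeasurableSet {x : V | inner ℝ v x ≤ t} :=
  (isClosed_le (by fun_prop) continuous_const).measurableSet

lemma measurableSet_halfSpacePolarize (v : V) (t : ℝ) {E : Set V} (hE : MeasurableSet E) :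
    MeasurableSet (halfSpacePolarize v t E) :=
  measurableSet_polarize (measurePreserving_hyperplaneReflection v t).measurable
    (measurableSet_halfSpace v t) hE

lemma volume_halfSpacePolarize {v : V} (hv : v ≠ 0) (t : ℝ) {E : Set V} (hE : MeasurableSet E) :
    volume (halfSpacePolarize v t E) = volume E :=
  measure_polarize (measurePreserving_hyperplaneReflection v t)
    (hyperplaneReflection_involutive hv t) (measurableSet_halfSpace v t) (halfSpace_cover hv t)
    (hyperplaneReflection_eq_self hv t) hE

/-- The condition `0 ≤ t` puts the origin in the half space, so all centred balls are favoured at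
once. The second term is the mass moved from outside the ball into its unfilled part. -/
lemma volume_halfSpacePolarize_diff_ball_add_le {v : V} (hv : v ≠ 0) {t : ℝ} (ht : 0 ≤ t)
    {E : Set V} (hE : MeasurableSet E) (r : ℝ) :
    volume (halfSpacePolarize v t E \ Metric.ball 0 r) +
      volume {x | x ∉ {x : V | inner ℝ v x ≤ t} ∧ x ∈ E \ Metric.ball 0 r ∧
        hyperplaneReflection v t x ∈ Metric.ball 0 r \ E} ≤ volume (E \ Metric.ball 0 r) := by
  refine measure_polarize_diff_add_le (measurePreserving_hyperplaneReflection v t)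
    (hyperplaneReflection_involutive hv t) (measurableSet_halfSpace v t) (halfSpace_cover hv t)
    (hyperplaneReflection_eq_self hv t) hE measurableSet_ball fun x hx hx' => ?_
  rw [mem_ball_zero_iff] at hx' ⊢
  refine lt_of_le_of_lt ?_ hx'
  simpa using norm_sub_le_norm_hyperplaneReflection_sub hv (y := 0) hx (by simpa using ht)

lemma interaction_halfSpacePolarize_compl_le {v : V} (hv : v ≠ 0) (t : ℝ) {k : ℝ → ℝ≥0∞}
    (hk : Antitone k) {E : Set V} (hE : MeasurableSet E) :
    interaction k (halfSpacePolarize v t E) (halfSpacePolarize v t E)ᶜ ≤ interaction k E Eᶜ :=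
  lintegral_polarize_compl_le (K := fun x y => k ‖x - y‖) (measurePreserving_hyperplaneReflection v t)
    (hyperplaneReflection_involutive hv t) (measurableSet_halfSpace v t) (halfSpace_cover hv t)
    (hyperplaneReflection_eq_self hv t) (measurable_norm_sub_kernel hk.measurable)
    (fun x y => by rw [norm_hyperplaneReflection_sub])
    (fun _ hx _ hy => hk (norm_sub_le_norm_hyperplaneReflection_sub hv hx hy)) hE

/-! ### Averaging over all reflections -/

lemma lintegral_comp_sub_smul {W : Type*} [NormedAddCommGroup W] [NormedSpace ℝ W]
    [FiniteDimensional ℝ W] [MeasurableSpace W] [BorelSpace W] (μ : Measure W)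
    [μ.IsAddHaarMeasure] {f : W → ℝ≥0∞} (hf : Measurable f) (x : W) {a : ℝ} (ha : a ≠ 0) :
    ∫⁻ w, f (x - a • w) ∂μ = ENNReal.ofReal |(a ^ Module.finrank ℝ W)⁻¹| * ∫⁻ w, f w ∂μ := by
  have h1 : ∫⁻ w, f (x - a • w) ∂μ = ∫⁻ w, f (x - w) ∂(Measure.map (fun w => a • w) μ) := by
    rw [lintegral_map (f := fun w => f (x - w)) (hf.comp (by fun_prop)) (measurable_const_smul a)]
  rw [h1, Measure.map_addHaar_smul μ ha, lintegral_smul_measure, lintegral_sub_left_eq_self,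
    smul_eq_mul]

/-- For a fixed point `x`, the reflections taking `x` into `C` have a definite weight. -/
lemma le_lintegral_reflection_mem {R δ : ℝ} (hδ : 0 ≤ δ) {C : Set V} (hC : MeasurableSet C)
    {x : V} (hx : ‖x‖ ≤ R) (hCx : ∀ y ∈ C, ‖y‖ < ‖x‖) :
    ENNReal.ofReal ((4 ^ Module.finrank ℝ V)⁻¹ * (δ ^ 2 / 16)) *
        (volume C - volume (Metric.ball (0 : V) δ)) ≤
      ∫⁻ v in Metric.closedBall (0 : V) R, ∫⁻ t in Icc 0 (R ^ 2),
        {t | t < inner ℝ v x ∧ hyperplaneReflection v t x ∈ C}.indicator 1 t := by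
  have hR : 0 ≤ R := (norm_nonneg x).trans hx
  -- the weight of a single normal direction
  have h1 : ∀ v : V, ENNReal.ofReal (‖v‖ ^ 2) *
        ∫⁻ τ in Icc (1 : ℝ) 2, C.indicator 1 (x - (2 * τ) • v) ≤
      (Metric.closedBall (0 : V) R).indicator (fun v => ∫⁻ t in Icc 0 (R ^ 2),
        {t | t < inner ℝ v x ∧ hyperplaneReflection v t x ∈ C}.indicator 1 t) v := by
    intro v
    rcases eq_or_ne v 0 with rfl | hv
    · simp
    have hv' : 0 < ‖v‖ := norm_pos_iff.2 hv
    -- The level `⟪v, x⟫ - ‖v‖² τ` reflects `x` to `x - 2 τ v`. Landing closer to the origin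
    -- confines both the normal and the level to the bounded parameter region.
    have geom : ∀ τ ∈ Icc (1 : ℝ) 2, x - (2 * τ) • v ∈ C →
        ‖v‖ ≤ R ∧ 0 ≤ inner ℝ v x - ‖v‖ ^ 2 * τ ∧ inner ℝ v x - ‖v‖ ^ 2 * τ ≤ R ^ 2 := by
      intro τ hτ hC
      have h := hCx _ hC
      have e : ‖x - (2 * τ) • v‖ ^ 2 = ‖x‖ ^ 2 - 4 * τ * (inner ℝ v x - ‖v‖ ^ 2 * τ) := by
        rw [norm_sub_sq_real, inner_smul_right, norm_smul, real_inner_comm, mul_pow,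
          Real.norm_eq_abs, sq_abs]
        ring
      have h2 : ‖x - (2 * τ) • v‖ ^ 2 ≤ ‖x‖ ^ 2 := by gcongr
      have hτ1 := hτ.1
      have h3 : 0 ≤ inner ℝ v x - ‖v‖ ^ 2 * τ := by
        by_contra hneg
        push Not at hneg
        nlinarith
      refine ⟨?_, h3, ?_⟩
      · have : ‖(2 * τ) • v‖ ≤ ‖x‖ + ‖x - (2 * τ) • v‖ := by
          calc ‖(2 * τ) • v‖ = ‖x - (x - (2 * τ) • v)‖ := by rw [sub_sub_cancel]
            _ ≤ _ := norm_sub_le _ _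
        rw [norm_smul, Real.norm_of_nonneg (by linarith)] at this
        nlinarith
      · have : 0 ≤ ‖x - (2 * τ) • v‖ ^ 2 := by positivity
        have : ‖x‖ ^ 2 ≤ R ^ 2 := by gcongr
        nlinarith
    have hm : MeasurableSet {t : ℝ | t < inner ℝ v x ∧ hyperplaneReflection v t x ∈ C} := by
      refine measurableSet_Iio.inter (hC.preimage ?_)
      unfold hyperplaneReflection
      fun_prop
    by_cases hvR : v ∈ Metric.closedBall (0 : V) R
    · rw [indicator_of_mem hvR, ← lintegral_indicator (measurableSet_Icc (a := (0 : ℝ)) (b := R ^ 2))]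
      have mm : Measurable ((Icc (0 : ℝ) (R ^ 2)).indicator
          ({t | t < inner ℝ v x ∧ hyperplaneReflection v t x ∈ C}.indicator (1 : ℝ → ℝ≥0∞))) :=
        (measurable_one.indicator hm).indicator measurableSet_Icc
      have h2 := lintegral_comp_sub_smul volume mm (inner ℝ v x) (a := ‖v‖ ^ 2) (by positivity)
      have e : ENNReal.ofReal (‖v‖ ^ 2) * ENNReal.ofReal |((‖v‖ ^ 2) ^ Module.finrank ℝ ℝ)⁻¹| = 1 := by
        rw [Module.finrank_self, pow_one, abs_of_pos (by positivity),
          ← ENNReal.ofReal_mul (by positivity), mul_inv_cancel₀ (by positivity), ENNReal.ofReal_one]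
      rw [← one_mul (∫⁻ t, (Icc (0 : ℝ) (R ^ 2)).indicator _ t), ← e, mul_assoc, ← h2]
      refine mul_le_mul' le_rfl ?_
      rw [← lintegral_indicator measurableSet_Icc]
      refine lintegral_mono fun τ => ?_
      by_cases hτ : τ ∈ Icc (1 : ℝ) 2 ∧ x - (2 * τ) • v ∈ C
      · have hg := geom τ hτ.1 hτ.2
        have hτ1 := hτ.1.1
        have e2 : hyperplaneReflection v (inner ℝ v x - ‖v‖ ^ 2 * τ) x = x - (2 * τ) • v := by
          rw [hyperplaneReflection]
          congr 2
          field_simp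
          ring
        have h3 : inner ℝ v x - ‖v‖ ^ 2 • τ ∈ Icc (0 : ℝ) (R ^ 2) := ⟨hg.2.1, hg.2.2⟩
        have h4 : inner ℝ v x - ‖v‖ ^ 2 • τ ∈
            {t | t < inner ℝ v x ∧ hyperplaneReflection v t x ∈ C} := by
          refine ⟨?_, ?_⟩
          · rw [smul_eq_mul]
            have : 0 < ‖v‖ ^ 2 * τ := by positivity
            linarith
          · rw [smul_eq_mul, e2]; exact hτ.2
        rw [indicator_of_mem h3, indicator_of_mem h4, indicator_of_mem hτ.1,
          indicator_of_mem hτ.2]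
        simp
      · have : (Icc (1 : ℝ) 2).indicator (fun τ => C.indicator (1 : V → ℝ≥0∞) (x - (2 * τ) • v)) τ
            = 0 := by
          by_cases h : τ ∈ Icc (1 : ℝ) 2
          · rw [indicator_of_mem h, indicator_of_notMem fun h' => hτ ⟨h, h'⟩]
          · rw [indicator_of_notMem h]
        rw [this]
        exact zero_le
    · have h0 : ∫⁻ τ in Icc (1 : ℝ) 2, C.indicator (1 : V → ℝ≥0∞) (x - (2 * τ) • v) = 0 := by
        rw [setLIntegral_congr_fun measurableSet_Icc (g := 0), Pi.zero_def, lintegral_zero]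
        intro τ hτ
        refine indicator_of_notMem (fun h => hvR ?_) _
        rw [mem_closedBall_zero_iff]
        exact (geom τ hτ h).1
      rw [h0, mul_zero]
      exact zero_le
  -- points of `C` that are not close to `x`
  have h2 : ENNReal.ofReal (δ ^ 2) * (volume C - volume (Metric.ball (0 : V) δ)) ≤
      ∫⁻ y, ENNReal.ofReal (‖x - y‖ ^ 2) * C.indicator 1 y := by
    have : volume (Metric.ball (0 : V) δ) = volume (Metric.ball x δ) := by
      rw [Measure.addHaar_ball_center _ x]
    rw [this]
    calc ENNReal.ofReal (δ ^ 2) * (volume C - volume (Metric.ball x δ))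
        ≤ ENNReal.ofReal (δ ^ 2) * volume (C \ Metric.ball x δ) := by
          gcongr; exact le_measure_sdiff
      _ = ∫⁻ y, (C \ Metric.ball x δ).indicator (fun _ => ENNReal.ofReal (δ ^ 2)) y := by
          rw [lintegral_indicator (hC.diff measurableSet_ball), lintegral_const,
            Measure.restrict_apply_univ]
      _ ≤ _ := by
          refine lintegral_mono fun y => ?_
          by_cases hy : y ∈ C \ Metric.ball x δ
          · have hd : δ ≤ ‖x - y‖ := by
              have := hy.2
              rw [mem_ball_iff_norm, not_lt, norm_sub_rev] at this
              exact this
            rw [indicator_of_mem hy, indicator_of_mem hy.1, Pi.one_apply, mul_one]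
            gcongr
          · rw [indicator_of_notMem hy]; exact zero_le
  have mC : Measurable (C.indicator (1 : V → ℝ≥0∞)) := measurable_one.indicator hC
  have mh : Measurable fun y => ENNReal.ofReal (‖x - y‖ ^ 2) * C.indicator 1 y := by
    fun_prop
  -- Substituting `y = x - 2 τ v` produces the Jacobian `(2 τ)^(-dim V)` and `‖v‖² = ‖x - y‖² / (2
  -- τ)²`; the constants are those at `τ = 2`.
  have h3 : ∀ τ ∈ Icc (1 : ℝ) 2,
      ENNReal.ofReal ((4 ^ Module.finrank ℝ V)⁻¹ / 16) *
        ∫⁻ y, ENNReal.ofReal (‖x - y‖ ^ 2) * C.indicator 1 y ≤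
      ∫⁻ v, ENNReal.ofReal (‖v‖ ^ 2) * C.indicator 1 (x - (2 * τ) • v) := by
    intro τ hτ
    have hτ0 : 0 < τ := zero_lt_one.trans_le hτ.1
    have := lintegral_comp_sub_smul volume mh x (a := 2 * τ) (by positivity)
    have e : ∀ v : V, ENNReal.ofReal (‖v‖ ^ 2) * C.indicator 1 (x - (2 * τ) • v) =
        ENNReal.ofReal (((2 * τ) ^ 2)⁻¹) *
          (ENNReal.ofReal (‖x - (x - (2 * τ) • v)‖ ^ 2) * C.indicator 1 (x - (2 * τ) • v)) := by
      intro v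
      rw [← mul_assoc, ← ENNReal.ofReal_mul (by positivity), sub_sub_cancel, norm_smul,
        Real.norm_of_nonneg (by positivity)]
      congr 2
      field_simp
    simp_rw [e]
    rw [lintegral_const_mul _ (by fun_prop), this, ← mul_assoc,
      ← ENNReal.ofReal_mul (by positivity)]
    gcongr
    rw [abs_of_pos (by positivity), div_eq_inv_mul]
    have h4 : 2 * τ ≤ 4 := by linarith [hτ.2]
    have h5 : (2 * τ) ^ 2 ≤ 16 := by nlinarith
    gcongr
  calc _ = ENNReal.ofReal ((4 ^ Module.finrank ℝ V)⁻¹ / 16) * (ENNReal.ofReal (δ ^ 2) *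
        (volume C - volume (Metric.ball (0 : V) δ))) := by
        rw [← mul_assoc, ← ENNReal.ofReal_mul (by positivity)]
        congr 2
        ring
    _ ≤ ENNReal.ofReal ((4 ^ Module.finrank ℝ V)⁻¹ / 16) *
        ∫⁻ y, ENNReal.ofReal (‖x - y‖ ^ 2) * C.indicator 1 y := by gcongr
    _ = ∫⁻ _ in Icc (1 : ℝ) 2, ENNReal.ofReal ((4 ^ Module.finrank ℝ V)⁻¹ / 16) *
        ∫⁻ y, ENNReal.ofReal (‖x - y‖ ^ 2) * C.indicator 1 y := by
        rw [setLIntegral_const, Real.volume_Icc]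
        norm_num
    _ ≤ ∫⁻ τ in Icc (1 : ℝ) 2, ∫⁻ v, ENNReal.ofReal (‖v‖ ^ 2) *
          C.indicator 1 (x - (2 * τ) • v) := setLIntegral_mono' measurableSet_Icc h3
    _ = ∫⁻ v, ∫⁻ τ in Icc (1 : ℝ) 2, ENNReal.ofReal (‖v‖ ^ 2) *
          C.indicator 1 (x - (2 * τ) • v) := by
        refine lintegral_lintegral_swap (Measurable.aemeasurable ?_)
        unfold Function.uncurry
        fun_prop
    _ = ∫⁻ v, ENNReal.ofReal (‖v‖ ^ 2) * ∫⁻ τ in Icc (1 : ℝ) 2,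
          C.indicator 1 (x - (2 * τ) • v) := by
        refine lintegral_congr fun v => lintegral_const_mul _ ?_
        fun_prop
    _ ≤ _ := by
        rw [← lintegral_indicator Metric.isClosed_closedBall.measurableSet]
        exact lintegral_mono h1

/-- Among all hyperplanes with the origin on a fixed side there is one whose reflection maps a
definite part of `A` into `C`. -/
lemma exists_reflection_gain [Nontrivial V] (R : ℝ) {d : ℝ≥0∞} (hd : d ≠ 0) :
    ∃ φ : ℝ≥0∞, φ ≠ 0 ∧ ∀ A C : Set V, MeasurableSet A → MeasurableSet C → (∀ x ∈ A, ‖x‖ ≤ R) →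
      (∀ x ∈ A, ∀ y ∈ C, ‖y‖ < ‖x‖) → d ≤ volume A → d ≤ volume C →
      ∃ v : V, ∃ t : ℝ, v ≠ 0 ∧ 0 ≤ t ∧
        φ ≤ volume {x | t < inner ℝ v x ∧ x ∈ A ∧ hyperplaneReflection v t x ∈ C} := by
  have hball : Filter.Tendsto (fun δ => volume (Metric.ball (0 : V) δ)) (nhdsWithin 0 (Ioi 0))
      (nhds 0) := by
    have h : ∀ᶠ δ : ℝ in nhdsWithin 0 (Ioi 0), ENNReal.ofReal (δ ^ Module.finrank ℝ V) *
        volume (Metric.ball (0 : V) 1) = volume (Metric.ball (0 : V) δ) := by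
      filter_upwards [self_mem_nhdsWithin] with δ hδ
      rw [Measure.addHaar_ball _ _ (le_of_lt hδ)]
    refine Filter.Tendsto.congr' h ?_
    have h1 : Continuous fun δ : ℝ => ENNReal.ofReal (δ ^ Module.finrank ℝ V) *
        volume (Metric.ball (0 : V) 1) :=
      ENNReal.continuous_mul_const measure_ball_lt_top.ne |>.comp
        (ENNReal.continuous_ofReal.comp (continuous_pow _))
    have := (h1.tendsto 0).mono_left (nhdsWithin_le_nhds (s := Ioi 0))
    simpa [Module.finrank_pos.ne'] using this
  -- Removing a ball of radius `δ` around any point leaves a definite part of every `C` with `d ≤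
  -- volume C`.
  obtain ⟨δ, hδd, hδ⟩ : ∃ δ : ℝ, volume (Metric.ball (0 : V) δ) < d ∧ 0 < δ :=
    ((hball.eventually (gt_mem_nhds (pos_iff_ne_zero.2 hd))).and self_mem_nhdsWithin).exists
  set m₀ : ℝ≥0∞ := ENNReal.ofReal ((4 ^ Module.finrank ℝ V)⁻¹ * (δ ^ 2 / 16)) *
    (d - volume (Metric.ball (0 : V) δ)) * d with hm₀
  have hm₀0 : m₀ ≠ 0 := by
    refine mul_ne_zero (mul_ne_zero ?_ (tsub_pos_of_lt hδd).ne') hd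
    have : 0 < ((4 : ℝ) ^ Module.finrank ℝ V)⁻¹ * (δ ^ 2 / 16) := by positivity
    simpa using this
  set Q : ℝ≥0∞ := volume (Icc (0 : ℝ) (R ^ 2)) * volume (Metric.closedBall (0 : V) R) with hQ
  have hQtop : Q ≠ ∞ := ENNReal.mul_ne_top (by simp) measure_closedBall_lt_top.ne
  -- Pigeonhole: `m₀` bounds the total gain below and `Q` is the mass of the parameter region, so
  -- some reflection gains about the average `m₀ / Q`. The minimum with `1` keeps the value finite,
  -- and `Q + 1` makes the final comparison strict.
  refine ⟨min m₀ 1 / (Q + 1), ?_, ?_⟩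
  · refine (ENNReal.div_pos ?_ (by simp [hQtop])).ne'
    simp [hm₀0]
  intro A C hA hC hAR hAC hdA hdC
  by_contra! hcon
  let S : Set ((V × ℝ) × V) := {p | p.1.2 < inner ℝ p.1.1 p.2 ∧ p.2 ∈ A ∧
    hyperplaneReflection p.1.1 p.1.2 p.2 ∈ C}
  have mS : MeasurableSet S := by
    refine (measurableSet_lt (f := fun p : (V × ℝ) × V => p.1.2)
      (g := fun p => inner ℝ p.1.1 p.2) (by fun_prop) (by fun_prop)).inter
      ((hA.preimage measurable_snd).inter (hC.preimage ?_))
    unfold hyperplaneReflection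
    fun_prop
  let F : V × ℝ → V → ℝ≥0∞ := fun p x => S.indicator 1 (p, x)
  have mF : Measurable fun p : (V × ℝ) × V => F p.1 p.2 := measurable_one.indicator mS
  have hF : ∀ v t, ∫⁻ x, F (v, t) x =
      volume {x | t < inner ℝ v x ∧ x ∈ A ∧ hyperplaneReflection v t x ∈ C} := by
    intro v t
    exact lintegral_indicator_one (mS.preimage (measurable_prodMk_left (x := (v, t))))
  have upper : ∫⁻ v in Metric.closedBall (0 : V) R, ∫⁻ t in Icc 0 (R ^ 2), ∫⁻ x, F (v, t) x ≤
      min m₀ 1 / (Q + 1) * Q := by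
    calc _ ≤ ∫⁻ v in Metric.closedBall (0 : V) R, ∫⁻ t in Icc (0 : ℝ) (R ^ 2),
          min m₀ 1 / (Q + 1) := by
          refine lintegral_mono fun v => setLIntegral_mono' measurableSet_Icc fun t ht => ?_
          rw [hF]
          rcases eq_or_ne v 0 with rfl | hv
          · simp [ht.1.not_gt]
          · exact (hcon v t hv ht.1).le
      _ = _ := by
          rw [setLIntegral_const, setLIntegral_const, hQ, mul_assoc]
  have lower : m₀ ≤ ∫⁻ v in Metric.closedBall (0 : V) R, ∫⁻ t in Icc 0 (R ^ 2),
      ∫⁻ x, F (v, t) x := by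
    have e : ∫⁻ v in Metric.closedBall (0 : V) R, ∫⁻ t in Icc 0 (R ^ 2), ∫⁻ x, F (v, t) x =
        ∫⁻ x, ∫⁻ v in Metric.closedBall (0 : V) R, ∫⁻ t in Icc 0 (R ^ 2), F (v, t) x := by
      have m1 : Measurable fun p : V × ℝ => ∫⁻ x, F p x := mF.lintegral_prod_right'
      rw [lintegral_lintegral m1.aemeasurable, lintegral_lintegral_swap mF.aemeasurable]
      refine lintegral_congr fun x => ?_
      rw [lintegral_prod]
      exact (mF.comp measurable_prodMk_right).aemeasurable
    rw [e]
    calc m₀ ≤ ENNReal.ofReal ((4 ^ Module.finrank ℝ V)⁻¹ * (δ ^ 2 / 16)) *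
          (volume C - volume (Metric.ball (0 : V) δ)) * volume A := by rw [hm₀]; gcongr
      _ = ∫⁻ _ in A, ENNReal.ofReal ((4 ^ Module.finrank ℝ V)⁻¹ * (δ ^ 2 / 16)) *
          (volume C - volume (Metric.ball (0 : V) δ)) := by rw [setLIntegral_const]
      _ ≤ ∫⁻ x in A, ∫⁻ v in Metric.closedBall (0 : V) R, ∫⁻ t in Icc 0 (R ^ 2), F (v, t) x := by
          refine setLIntegral_mono' hA fun x hx => ?_
          refine (le_lintegral_reflection_mem hδ.le hC (hAR x hx) (hAC x hx)).trans_eq ?_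
          refine lintegral_congr fun v => lintegral_congr fun t => ?_
          by_cases h : t < inner ℝ v x ∧ hyperplaneReflection v t x ∈ C
          · have hS : ((v, t), x) ∈ S := ⟨h.1, hx, h.2⟩
            exact (indicator_of_mem (a := t) h 1).trans (indicator_of_mem hS 1).symm
          · have hS : ((v, t), x) ∉ S := fun h' => h ⟨h'.1, h'.2.2⟩
            exact (indicator_of_notMem (a := t) h 1).trans (indicator_of_notMem hS 1).symm
      _ ≤ _ := setLIntegral_le_lintegral _ _
  have h1 : min m₀ 1 ≤ min m₀ 1 / (Q + 1) * Q := (min_le_left _ _).trans (lower.trans upper)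
  have h2 : min m₀ 1 / (Q + 1) * Q < min m₀ 1 / (Q + 1) * (Q + 1) := by
    have ha : min m₀ 1 / (Q + 1) ≠ 0 := (ENNReal.div_pos (by simp [hm₀0]) (by simp [hQtop])).ne'
    have hb : min m₀ 1 / (Q + 1) ≠ ∞ :=
      ENNReal.div_ne_top (ne_top_of_le_ne_top ENNReal.one_ne_top (min_le_right _ _)) (by simp)
    exact (ENNReal.mul_lt_mul_iff_right ha hb).2 (ENNReal.lt_add_right hQtop one_ne_zero)
  rw [ENNReal.div_mul_cancel (by simp) (by simp [hQtop])] at h2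
  exact absurd h1 (not_le.2 h2)

end Measure

end

section

variable {V : Type*} [NormedAddCommGroup V] [InnerProductSpace ℝ V]
  [FiniteDimensional ℝ V] [MeasurableSpace V] [BorelSpace V]

/-! ### Balls minimize the energy -/

/-- Sets of the same volume as `E`, with smaller energies and more concentrated at the origin,
come arbitrarily close to the ball. -/
lemma exists_concentrated [Nontrivial V] {k : ℝ → ℝ≥0∞} (hk : Antitone k) {E : Set V}
    (hE : MeasurableSet E) {ρ : ℝ} (hρ : volume (Metric.ball (0 : V) ρ) = volume E)
    {ε : ℝ≥0∞} (hε : ε ≠ 0) :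
    ∃ F : Set V, MeasurableSet F ∧ volume F = volume E ∧
      interaction k F Fᶜ ≤ interaction k E Eᶜ ∧ volume (F \ Metric.ball 0 ρ) < ε := by
  have hEtop : volume E ≠ ∞ := hρ ▸ measure_ball_lt_top.ne
  -- Control at every radius, not only at `ρ`, gives tightness: no competitor has more mass far away
  -- than `E`.
  let S : Set (Set V) := {F | MeasurableSet F ∧ volume F = volume E ∧
    interaction k F Fᶜ ≤ interaction k E Eᶜ ∧
    ∀ r, volume (F \ Metric.ball 0 r) ≤ volume (E \ Metric.ball 0 r)}
  have hES : E ∈ S := ⟨hE, rfl, le_rfl, fun _ => le_rfl⟩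
  set d : ℝ≥0∞ := ⨅ F ∈ S, volume (F \ Metric.ball 0 ρ) with hd
  suffices h : d = 0 by
    have : d < ε := h ▸ pos_iff_ne_zero.2 hε
    obtain ⟨F, hF⟩ := iInf_lt_iff.1 this
    obtain ⟨hFS, hF⟩ := iInf_lt_iff.1 hF
    exact ⟨F, hFS.1, hFS.2.1, hFS.2.2.1, hF⟩
  by_contra hd0
  have hdtop : d ≠ ∞ :=
    ne_top_of_le_ne_top hEtop ((iInf₂_le E hES).trans (measure_mono sdiff_subset))
  have hd2 : d / 2 ≠ 0 := (ENNReal.half_pos hd0).ne'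
  obtain ⟨N, hN⟩ : ∃ N : ℕ, volume (E \ Metric.ball 0 N) < d / 2 := by
    have h := tendsto_measure_iInter_atTop (μ := volume)
      (s := fun N : ℕ => E \ Metric.ball (0 : V) N)
      (fun N => (hE.diff measurableSet_ball).nullMeasurableSet)
      (fun N M hNM => sdiff_subset_sdiff_right (Metric.ball_subset_ball (by exact_mod_cast hNM)))
      ⟨0, ne_top_of_le_ne_top hEtop (measure_mono sdiff_subset)⟩
    have e : ⋂ N : ℕ, E \ Metric.ball (0 : V) N = ∅ := by
      refine eq_empty_of_forall_notMem fun x hx => ?_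
      obtain ⟨N, hN⟩ := exists_nat_gt ‖x‖
      exact (mem_iInter.1 hx N).2 (by simpa using hN)
    rw [e, measure_empty] at h
    exact (h.eventually (gt_mem_nhds (pos_iff_ne_zero.2 hd2))).exists
  obtain ⟨φ, hφ0, hφ⟩ := exists_reflection_gain (V := V) N hd2
  -- `F` is within `φ` of the infimum, while one more polarization gains at least `φ` and stays in
  -- `S`.
  obtain ⟨F, hF⟩ := iInf_lt_iff.1 (ENNReal.lt_add_right hdtop hφ0)
  obtain ⟨⟨hFm, hFv, hFk, hFr⟩, hF⟩ := iInf_lt_iff.1 hF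
  have hFd : d ≤ volume (F \ Metric.ball 0 ρ) := iInf₂_le F ⟨hFm, hFv, hFk, hFr⟩
  have hA : d / 2 ≤ volume ((F \ Metric.ball 0 ρ) ∩ Metric.ball 0 N) := by
    by_contra! hlt
    have h1 : volume ((F \ Metric.ball 0 ρ) \ Metric.ball 0 N) < d / 2 :=
      (measure_mono (sdiff_subset_sdiff_left sdiff_subset)).trans_lt ((hFr N).trans_lt hN)
    have h2 := measure_inter_add_sdiff (μ := volume) (F \ Metric.ball 0 ρ)
      (measurableSet_ball (x := (0 : V)) (ε := N))
    have h3 := ENNReal.add_lt_add hlt h1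
    rw [h2, ENNReal.add_halves] at h3
    exact absurd hFd (not_le.2 h3)
  have hC : d / 2 ≤ volume (Metric.ball 0 ρ \ F) := by
    have h1 := measure_inter_add_sdiff (μ := volume) F (measurableSet_ball (x := (0 : V)) (ε := ρ))
    have h2 := measure_inter_add_sdiff (μ := volume) (Metric.ball (0 : V) ρ) hFm
    rw [hρ, ← hFv, ← h1, inter_comm] at h2
    have h3 : volume (F ∩ Metric.ball 0 ρ) ≠ ∞ :=
      ne_top_of_le_ne_top measure_ball_lt_top.ne (measure_mono inter_subset_right)
    rw [(ENNReal.add_right_inj h3).1 h2]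
    exact ENNReal.half_le_self.trans hFd
  obtain ⟨v, t, hv, ht, hvt⟩ := hφ _ _ ((hFm.diff measurableSet_ball).inter measurableSet_ball)
    (measurableSet_ball.diff hFm) (fun x hx => (mem_ball_zero_iff.1 hx.2).le)
    (fun x hx y hy => (mem_ball_zero_iff.1 hy.1).trans_le
      (not_lt.1 fun h => hx.1.2 (mem_ball_zero_iff.2 h))) hA hC
  have hgain := volume_halfSpacePolarize_diff_ball_add_le hv ht hFm ρ
  have hPS : halfSpacePolarize v t F ∈ S := by
    refine ⟨measurableSet_halfSpacePolarize v t hFm, (volume_halfSpacePolarize hv t hFm).trans hFv,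
      (interaction_halfSpacePolarize_compl_le hv t hk hFm).trans hFk, fun r => ?_⟩
    exact (le_self_add.trans (volume_halfSpacePolarize_diff_ball_add_le hv ht hFm r)).trans (hFr r)
  have h1 : φ ≤ volume {x | x ∉ {x : V | inner ℝ v x ≤ t} ∧ x ∈ F \ Metric.ball 0 ρ ∧
      hyperplaneReflection v t x ∈ Metric.ball 0 ρ \ F} :=
    hvt.trans (measure_mono fun x hx => ⟨not_le.2 hx.1, hx.2.1.1, hx.2.2⟩)
  have h2 : d + φ ≤ volume (F \ Metric.ball 0 ρ) :=
    (add_le_add (iInf₂_le _ hPS) h1).trans hgain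
  exact absurd hF (not_lt.2 h2)

/-- Competitors of no larger energy come arbitrarily close to the ball in measure, and finite kernel
mass makes the energy continuous there. No limit set has to be extracted. -/
theorem interaction_ball_compl_le [Nontrivial V] {k : ℝ → ℝ≥0∞} (hk : Antitone k)
    (hfin : ∫⁻ y : V, k ‖y‖ ≠ ∞) {E : Set V} (hE : MeasurableSet E) {ρ : ℝ}
    (hρ : volume (Metric.ball (0 : V) ρ) = volume E) :
    interaction k (Metric.ball (0 : V) ρ) (Metric.ball 0 ρ)ᶜ ≤ interaction k E Eᶜ := by
  refine ENNReal.le_of_forall_pos_le_add fun ε hε _ => ?_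
  set I := ∫⁻ y : V, k ‖y‖ with hI
  obtain ⟨F, hFm, hFv, hFk, hF⟩ := exists_concentrated hk hE hρ (ε := ε / (2 * I + 1))
    (ENNReal.div_pos (by exact_mod_cast hε.ne') (by finiteness)).ne'
  have hsymm : volume (Metric.ball 0 ρ \ F) = volume (F \ Metric.ball 0 ρ) := by
    have h1 := measure_inter_add_sdiff (μ := volume) F (measurableSet_ball (x := (0 : V)) (ε := ρ))
    have h2 := measure_inter_add_sdiff (μ := volume) (Metric.ball (0 : V) ρ) hFm
    rw [hρ, ← hFv, ← h1, inter_comm] at h2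
    have h3 : volume (F ∩ Metric.ball 0 ρ) ≠ ∞ :=
      ne_top_of_le_ne_top measure_ball_lt_top.ne (measure_mono inter_subset_right)
    exact (ENNReal.add_right_inj h3).1 h2
  calc _ ≤ interaction k F Fᶜ + I * (volume (F \ Metric.ball 0 ρ) + volume (Metric.ball 0 ρ \ F)) :=
        interaction_compl_le hk.measurable _ _
    _ ≤ interaction k E Eᶜ + ε := by
        gcongr
        rw [hsymm]
        calc I * (volume (F \ Metric.ball 0 ρ) + volume (F \ Metric.ball 0 ρ))
            = 2 * I * volume (F \ Metric.ball 0 ρ) := by ring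
          _ ≤ (2 * I + 1) * (ε / (2 * I + 1)) := by
            gcongr
            exact le_self_add
          _ = ε := ENNReal.mul_div_cancel (by simp) (by finiteness)

/-- A kernel may be exhausted by kernels of finite mass. -/
theorem interaction_ball_compl_le_of_forall_lt [Nontrivial V] {k : ℝ → ℝ≥0∞}
    (hk : AntitoneOn k (Ioi 0)) (hktop : ∀ r, k r ≠ ∞) {E : Set V} (hE : MeasurableSet E) {ρ : ℝ}
    (hρ : volume (Metric.ball (0 : V) ρ) = volume E) :
    interaction k (Metric.ball (0 : V) ρ) (Metric.ball 0 ρ)ᶜ ≤ interaction k E Eᶜ := by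
  -- truncate at small and at large distances
  let κ : ℕ → ℝ → ℝ≥0∞ := fun N r =>
    if r < N + 1 then k (max r (1 / ((N : ℝ) + 1))) else 0
  have hpos : ∀ N : ℕ, (0 : ℝ) < 1 / ((N : ℝ) + 1) := fun N => by positivity
  have hκ : ∀ N, Antitone (κ N) := by
    intro N r r' hr
    simp only [κ]
    split_ifs with h1 h2
    · exact hk (lt_max_of_lt_right (hpos N)) (lt_max_of_lt_right (hpos N))
        (max_le_max_right _ hr)
    · exact absurd (hr.trans_lt h1) h2
    · exact zero_le
    · exact le_rfl
  have hκmono : ∀ r, Monotone fun N => κ N r := by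
    intro r N M hNM
    have hNM' : (N : ℝ) ≤ M := by exact_mod_cast hNM
    simp only [κ]
    split_ifs with h1 h2
    · refine hk (lt_max_of_lt_right (hpos M)) (lt_max_of_lt_right (hpos N))
        (max_le_max_left _ ?_)
      gcongr
    · exact absurd (h1.trans_le (by linarith)) h2
    · exact zero_le
    · exact le_rfl
  have hκsup : ∀ r : ℝ, 0 < r → ⨆ N, κ N r = k r := by
    intro r hr
    refine le_antisymm (iSup_le fun N => ?_) ?_
    · simp only [κ]
      split_ifs
      · exact hk hr (lt_max_of_lt_left hr) (le_max_left _ _)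
      · exact zero_le
    · obtain ⟨N, hN⟩ := exists_nat_gt (max r (1 / r))
      have h1 : r < N := (le_max_left _ _).trans_lt hN
      have h2 : 1 / r < N := (le_max_right _ _).trans_lt hN
      refine le_iSup_of_le N ?_
      have h3 : 1 / ((N : ℝ) + 1) ≤ r := by
        rw [div_le_iff₀ (by positivity)]
        rw [div_lt_iff₀ hr] at h2
        nlinarith
      simp only [κ]
      rw [if_pos (by linarith), max_eq_left h3]
  have hκfin : ∀ N, ∫⁻ y : V, κ N ‖y‖ ≠ ∞ := by
    intro N
    have hle : ∀ y : V, κ N ‖y‖ ≤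
        (Metric.ball (0 : V) (N + 1)).indicator (fun _ => k (1 / ((N : ℝ) + 1))) y := by
      intro y
      by_cases hy : ‖y‖ < N + 1
      · rw [indicator_of_mem (mem_ball_zero_iff.2 hy)]
        simp only [κ, if_pos hy]
        exact hk (hpos N) (lt_max_of_lt_right (hpos N)) (le_max_right _ _)
      · simp only [κ, if_neg hy]
        exact zero_le
    refine ne_top_of_le_ne_top ?_ (lintegral_mono hle)
    rw [lintegral_indicator measurableSet_ball, setLIntegral_const]
    exact ENNReal.mul_ne_top (hktop _) measure_ball_lt_top.ne
  have hsup : ∀ A : Set V, MeasurableSet A → ⨆ N, interaction (κ N) A Aᶜ = interaction k A Aᶜ := by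
    intro A hA
    have mκ : ∀ N, Measurable fun p : V × V => κ N ‖p.1 - p.2‖ :=
      fun N => measurable_norm_sub_kernel (hκ N).measurable
    unfold interaction
    rw [← lintegral_iSup (fun N => (mκ N).lintegral_prod_right')
      (fun N M h x => lintegral_mono fun y => hκmono _ h)]
    refine setLIntegral_congr_fun hA fun x hx => ?_
    simp only
    rw [← lintegral_iSup (f := fun N y => κ N ‖x - y‖) (fun N => (mκ N).comp measurable_prodMk_left)
      (fun N M h y => hκmono _ h)]
    -- The truncations need to recover `k` only off the diagonal, which a set and its complement
    -- never meet.
    refine setLIntegral_congr_fun hA.compl fun y hy => hκsup _ ?_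
    rw [norm_pos_iff, sub_ne_zero]
    rintro rfl
    exact hy hx
  rw [← hsup _ measurableSet_ball, ← hsup _ hE]
  exact iSup_mono fun N => interaction_ball_compl_le (hκ N) (hκfin N) hE hρ

end

section

/-! ### One-dimensional and radial integrals -/

lemma lintegral_Ioi_rpow {s δ : ℝ} (hs : 0 < s) (hδ : 0 < δ) :
    ∫⁻ r in Ioi δ, ENNReal.ofReal (r ^ (-1 - s)) = ENNReal.ofReal (δ ^ (-s) / s) := by
  rw [← ofReal_integral_eq_lintegral_ofReal (integrableOn_Ioi_rpow_of_lt (by linarith) hδ),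
    integral_Ioi_rpow_of_lt (by linarith) hδ]
  · congr 1
    rw [show -1 - s + 1 = -s by ring, neg_div_neg_eq]
  · filter_upwards [ae_restrict_mem measurableSet_Ioi] with r hr
    exact Real.rpow_nonneg (hδ.le.trans (le_of_lt hr)) _

lemma lintegral_Ioo_rpow {s c : ℝ} (hs : s < 1) (hc : 0 ≤ c) :
    ∫⁻ r in Ioo 0 c, ENNReal.ofReal (r ^ (-s)) = ENNReal.ofReal (c ^ (1 - s) / (1 - s)) := by
  have hi := (intervalIntegral.intervalIntegrable_rpow' (a := 0) (b := c) (r := -s)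
    (by linarith)).1
  rw [restrict_Ioo_eq_restrict_Ioc, ← ofReal_integral_eq_lintegral_ofReal hi,
    ← intervalIntegral.integral_of_le hc, integral_rpow (.inl (by linarith)),
    Real.zero_rpow (by linarith), sub_zero]
  · rw [show -s + 1 = 1 - s by ring]
  · filter_upwards [ae_restrict_mem measurableSet_Ioc] with r hr
    exact Real.rpow_nonneg hr.1.le _

lemma lintegral_Ioo_sub_rpow {s a c : ℝ} (hs : s < 1) (hac : a ≤ c) :
    ∫⁻ r in Ioo a c, ENNReal.ofReal ((c - r) ^ (-s)) =
      ENNReal.ofReal ((c - a) ^ (1 - s) / (1 - s)) := by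
  rw [← lintegral_Ioo_rpow hs (sub_nonneg.2 hac), ← lintegral_indicator measurableSet_Ioo,
    ← lintegral_indicator measurableSet_Ioo, ← lintegral_sub_left_eq_self _ c]
  refine lintegral_congr fun r => ?_
  by_cases hr : r ∈ Ioo 0 (c - a)
  · rw [indicator_of_mem hr, indicator_of_mem (by constructor <;> linarith [hr.1, hr.2]),
      sub_sub_cancel]
  · rw [indicator_of_notMem hr, indicator_of_notMem]
    rintro ⟨h1, h2⟩
    exact hr ⟨by linarith, by linarith⟩

/-- Integrating a negative power of the distance to `ρ` over an interval to the left of `ρ`. -/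
lemma lintegral_Ioo_inter_Iic_rpow_le {s a b ρ : ℝ} (hs0 : 0 < s) (hs : s < 1) (hab : a ≤ b) :
    ∫⁻ r in Ioo a b, (Iic ρ).indicator (fun r => ENNReal.ofReal (ρ - r) ^ (-s)) r ≤
      ENNReal.ofReal ((b - a) ^ (1 - s) / (1 - s)) := by
  rcases le_or_gt ρ a with hρ | hρ
  · rw [setLIntegral_congr_fun measurableSet_Ioo (g := fun _ => 0)]
    · simp
    · intro r hr
      have h : r ∉ Iic ρ := fun h => absurd (hρ.trans_lt hr.1) (not_lt.2 h)
      simp [h]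
  -- Moving the singularity left from `ρ` to `m` only increases the integrand. The point `r = ρ` is
  -- excluded below because the integrand is `∞` there.
  set m := min ρ b with hm
  have ham : a ≤ m := le_min hρ.le hab
  have h1 : ∀ r ∈ Ioo a b, r ≠ ρ → (Iic ρ).indicator (fun r => ENNReal.ofReal (ρ - r) ^ (-s)) r ≤
      (Ioo a m).indicator (fun r => ENNReal.ofReal ((m - r) ^ (-s))) r := by
    intro r hr hrρ
    by_cases h : r ≤ ρ
    · have hlt : r < ρ := lt_of_le_of_ne h hrρ
      have hrm : r < m := lt_min hlt hr.2
      rw [indicator_of_mem (mem_Iic.2 h), indicator_of_mem (mem_Ioo.2 ⟨hr.1, hrm⟩),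
        ENNReal.ofReal_rpow_of_pos (by linarith)]
      refine ENNReal.ofReal_le_ofReal
        (Real.rpow_le_rpow_of_nonpos (by linarith) ?_ (by linarith))
      linarith [min_le_left ρ b]
    · rw [indicator_of_notMem (by simpa using h)]
      exact zero_le
  calc _ ≤ ∫⁻ r in Ioo a b, (Ioo a m).indicator (fun r => ENNReal.ofReal ((m - r) ^ (-s))) r := by
        refine lintegral_mono_ae ?_
        have hne : ∀ᵐ r ∂(volume.restrict (Ioo a b)), r ≠ ρ :=
          ae_restrict_of_ae (Measure.ae_ne volume ρ)
        filter_upwards [ae_restrict_mem measurableSet_Ioo, hne] with r hr hrρ using h1 r hr hrρ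
    _ ≤ ∫⁻ r, (Ioo a m).indicator (fun r => ENNReal.ofReal ((m - r) ^ (-s))) r :=
        setLIntegral_le_lintegral _ _
    _ = ENNReal.ofReal ((m - a) ^ (1 - s) / (1 - s)) := by
        rw [lintegral_indicator measurableSet_Ioo, lintegral_Ioo_sub_rpow hs ham]
    _ ≤ _ := by
        refine ENNReal.ofReal_le_ofReal (div_le_div_of_nonneg_right ?_ (by linarith))
        exact Real.rpow_le_rpow (by linarith) (by linarith [min_le_right ρ b]) (by linarith)

/-- Polar coordinates: off the origin the measure is a product of a sphere measure and a radial
density. -/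
lemma lintegral_fun_norm {V : Type*} [NormedAddCommGroup V] [NormedSpace ℝ V]
    [FiniteDimensional ℝ V] [MeasurableSpace V] [BorelSpace V] [Nontrivial V] (μ : Measure V)
    [μ.IsAddHaarMeasure] {f : ℝ → ℝ≥0∞} (hf : Measurable f) :
    ∫⁻ x, f ‖x‖ ∂μ = Module.finrank ℝ V * μ (Metric.ball 0 1) *
      ∫⁻ r in Ioi (0 : ℝ), ENNReal.ofReal (r ^ (Module.finrank ℝ V - 1)) * f r := by
  calc ∫⁻ x, f ‖x‖ ∂μ = ∫⁻ x in ({0}ᶜ : Set V), f ‖x‖ ∂μ := by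
        rw [restrict_compl_singleton]
    _ = ∫⁻ x : ({0}ᶜ : Set V), f ‖x.1‖ ∂(μ.comap (↑)) := by
        rw [lintegral_subtype_comap (measurableSet_singleton _).compl fun x => f ‖x‖]
    _ = ∫⁻ x, f x.2 ∂μ.toSphere.prod (.volumeIoiPow (Module.finrank ℝ V - 1)) := by
        simpa using μ.measurePreserving_homeomorphUnitSphereProd.lintegral_comp_emb
          (Homeomorph.measurableEmbedding _) (f ∘ Subtype.val ∘ Prod.snd)
    _ = μ.toSphere univ * ∫⁻ x : Ioi (0 : ℝ), f x ∂.volumeIoiPow (Module.finrank ℝ V - 1) := by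
        have hf' : Measurable fun x : Metric.sphere (0 : V) 1 × Ioi (0 : ℝ) => f x.2 :=
          hf.comp (measurable_subtype_coe.comp measurable_snd)
        rw [lintegral_prod _ hf'.aemeasurable]
        simp only
        rw [lintegral_const, mul_comm]
    _ = _ := by
        have hf' : Measurable fun x : Ioi (0 : ℝ) => f x := hf.comp measurable_subtype_coe
        rw [Measure.toSphere_apply_univ, Measure.volumeIoiPow,
          lintegral_withDensity_eq_lintegral_mul _ (by fun_prop) hf']
        congr 1
        exact lintegral_subtype_comap measurableSet_Ioi
          fun r => ENNReal.ofReal (r ^ (Module.finrank ℝ V - 1)) * f r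

/-! ### The fractional kernel -/

variable {n : ℕ}

lemma oball_eq_ball (r : ℝ) : oball n r = Metric.ball 0 r := by
  ext x; simp [oball]

/-- The radial profile of the fractional kernel. -/
def fracKernel (n : ℕ) (s : ℝ) (r : ℝ) : ℝ≥0∞ := ENNReal.ofReal (1 / r ^ ((n : ℝ) + s))

lemma fracPerimeter_eq_interaction (s : ℝ) (E : Set (EuclideanSpace ℝ (Fin n))) :
    fracPerimeter s E = interaction (fracKernel n s) E Eᶜ := rfl

lemma measurable_fracKernel (n : ℕ) (s : ℝ) : Measurable (fracKernel n s) := by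
  unfold fracKernel
  fun_prop

/-- The restriction to positive radii matters: at `0` division by zero gives the value `0`. -/
lemma antitoneOn_fracKernel {s : ℝ} (hs : 0 < s) : AntitoneOn (fracKernel n s) (Ioi 0) := by
  intro r hr r' _ hrr'
  have hr : 0 < r := hr
  refine ENNReal.ofReal_le_ofReal ?_
  have : 0 ≤ (n : ℝ) + s := by positivity
  gcongr

/-- The `(n-1)`-dimensional area `n |B|` of the unit sphere. -/
def sphereArea (n : ℕ) : ℝ≥0∞ := n * volume (Metric.ball (0 : EuclideanSpace ℝ (Fin n)) 1)

lemma sphereArea_ne_top (n : ℕ) : sphereArea n ≠ ∞ :=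
  ENNReal.mul_ne_top (ENNReal.natCast_ne_top n) measure_ball_lt_top.ne

lemma sphereArea_ne_zero (hn : 0 < n) : sphereArea n ≠ 0 :=
  mul_ne_zero (by exact_mod_cast hn.ne') (Metric.measure_ball_pos _ _ one_pos).ne'

/-- The mass of the fractional kernel at distance at least `δ` from its pole. -/
lemma lintegral_fracKernel_le (hn : 0 < n) {s δ : ℝ} (hs : 0 < s) (hδ : 0 ≤ δ)
    (x : EuclideanSpace ℝ (Fin n)) {B : Set (EuclideanSpace ℝ (Fin n))}
    (hB : ∀ y ∈ B, δ ≤ ‖x - y‖) :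
    ∫⁻ y in B, fracKernel n s ‖x - y‖ ≤
      sphereArea n / ENNReal.ofReal s * ENNReal.ofReal δ ^ (-s) := by
  have : Nonempty (Fin n) := ⟨⟨0, hn⟩⟩
  rcases hδ.eq_or_lt with rfl | hδ
  · rw [ENNReal.ofReal_zero, ENNReal.zero_rpow_of_neg (by linarith), ENNReal.mul_top]
    · exact le_top
    · exact (ENNReal.div_pos (sphereArea_ne_zero hn) ENNReal.ofReal_ne_top).ne'
  have mf : Measurable ((Ici δ).indicator (fracKernel n s)) :=
    (measurable_fracKernel n s).indicator measurableSet_Ici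
  calc ∫⁻ y in B, fracKernel n s ‖x - y‖
      ≤ ∫⁻ y in B, (Ici δ).indicator (fracKernel n s) ‖x - y‖ := by
        refine setLIntegral_mono ?_ fun y hy => ?_
        · exact mf.comp (measurable_const.sub measurable_id).norm
        · rw [indicator_of_mem (mem_Ici.2 (hB y hy))]
    _ ≤ ∫⁻ y, (Ici δ).indicator (fracKernel n s) ‖x - y‖ := setLIntegral_le_lintegral _ _
    _ = ∫⁻ y : EuclideanSpace ℝ (Fin n), (Ici δ).indicator (fracKernel n s) ‖y‖ :=
        lintegral_sub_left_eq_self (fun y => (Ici δ).indicator (fracKernel n s) ‖y‖) x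
    _ = sphereArea n * ∫⁻ r in Ioi (0 : ℝ), ENNReal.ofReal (r ^ (n - 1)) *
          (Ici δ).indicator (fracKernel n s) r := by
        rw [lintegral_fun_norm _ mf, finrank_euclideanSpace_fin, sphereArea]
    _ = sphereArea n * ∫⁻ r in Ioi δ, ENNReal.ofReal (r ^ (-1 - s)) := by
        congr 1
        rw [restrict_Ioi_eq_restrict_Ici (a := δ), ← lintegral_indicator measurableSet_Ici,
          ← lintegral_indicator measurableSet_Ioi]
        refine lintegral_congr fun r => ?_
        by_cases hr : r ∈ Ici δ
        · have hr0 : 0 < r := hδ.trans_le hr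
          rw [indicator_of_mem (mem_Ioi.2 hr0), indicator_of_mem hr, indicator_of_mem hr,
            fracKernel, ← ENNReal.ofReal_mul (by positivity)]
          congr 1
          rw [one_div, ← Real.rpow_neg hr0.le, ← Real.rpow_natCast, ← Real.rpow_add hr0,
            Nat.cast_pred hn]
          congr 1
          ring
        · rw [indicator_of_notMem hr]
          by_cases h : r ∈ Ioi (0 : ℝ) <;> simp [h, hr]
    _ = _ := by
        rw [lintegral_Ioi_rpow hs hδ, ENNReal.ofReal_rpow_of_pos hδ, ENNReal.ofReal_div_of_pos hs]
        simp only [div_eq_mul_inv]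
        ring

end

section

variable {n : ℕ}

/-! ### The fractional perimeter of balls and the fractional isoperimetric inequality -/

lemma lintegral_comp_smul {f : EuclideanSpace ℝ (Fin n) → ℝ≥0∞} (hf : Measurable f) {ρ : ℝ}
    (hρ : 0 < ρ) :
    ∫⁻ x, f x = ENNReal.ofReal (ρ ^ n) * ∫⁻ x, f (ρ • x) := by
  have h := lintegral_comp_sub_smul volume (f := fun x => f (-x)) (hf.comp measurable_neg) 0 hρ.ne'
  simp only [zero_sub, neg_neg, finrank_euclideanSpace_fin] at h
  rw [h, lintegral_neg_eq_self, ← mul_assoc, ← ENNReal.ofReal_mul (by positivity),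
    abs_of_pos (by positivity), mul_inv_cancel₀ (by positivity), ENNReal.ofReal_one, one_mul]

section

variable {V : Type*} [NormedAddCommGroup V] [InnerProductSpace ℝ V] [FiniteDimensional ℝ V]
  [MeasurableSpace V] [BorelSpace V]

/-- The kernel `k(|x - y|)`, cut off to `A × B`. -/
def indicatorKernel (k : ℝ → ℝ≥0∞) (A B : Set V) (x y : V) : ℝ≥0∞ :=
  A.indicator 1 x * (B.indicator 1 y * k ‖x - y‖)

lemma measurable_indicatorKernel {k : ℝ → ℝ≥0∞} (hk : Measurable k) {A B : Set V}
    (hA : MeasurableSet A) (hB : MeasurableSet B) :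
    Measurable (indicatorKernel k A B).uncurry := by
  have h1 : Measurable fun p : V × V => A.indicator (1 : V → ℝ≥0∞) p.1 :=
    (measurable_one.indicator hA).comp measurable_fst
  have h2 : Measurable fun p : V × V => B.indicator (1 : V → ℝ≥0∞) p.2 :=
    (measurable_one.indicator hB).comp measurable_snd
  exact h1.mul (h2.mul (measurable_norm_sub_kernel hk))

lemma interaction_eq_lintegral_indicatorKernel (k : ℝ → ℝ≥0∞) {A B : Set V}
    (hA : MeasurableSet A) (hB : MeasurableSet B) :
    interaction k A B = ∫⁻ x, ∫⁻ y, indicatorKernel k A B x y := by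
  rw [interaction, ← lintegral_indicator hA]
  refine lintegral_congr fun x => ?_
  by_cases hx : x ∈ A
  · rw [indicator_of_mem hx, ← lintegral_indicator hB]
    refine lintegral_congr fun y => ?_
    by_cases hy : y ∈ B <;> simp [indicatorKernel, hx, hy]
  · simp [indicatorKernel, hx]

end

/-- Rescaling the two variables contributes `ρ^(2n)` and the kernel `ρ^(-(n+s))`. -/
lemma fracPerimeter_ball (s : ℝ) {ρ : ℝ} (hρ : 0 < ρ) :
    fracPerimeter s (Metric.ball (0 : EuclideanSpace ℝ (Fin n)) ρ) =
      ENNReal.ofReal (ρ ^ ((n : ℝ) - s)) *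
        fracPerimeter s (Metric.ball (0 : EuclideanSpace ℝ (Fin n)) 1) := by
  have mB : ∀ r, MeasurableSet (Metric.ball (0 : EuclideanSpace ℝ (Fin n)) r) :=
    fun r => measurableSet_ball
  have mF : ∀ r, Measurable (indicatorKernel (fracKernel n s)
      (Metric.ball (0 : EuclideanSpace ℝ (Fin n)) r) (Metric.ball 0 r)ᶜ).uncurry := fun r =>
    measurable_indicatorKernel (measurable_fracKernel n s) (mB r) (mB r).compl
  have hk : ∀ x y : EuclideanSpace ℝ (Fin n), fracKernel n s ‖ρ • x - ρ • y‖ =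
      ENNReal.ofReal (ρ ^ (-((n : ℝ) + s))) * fracKernel n s ‖x - y‖ := by
    intro x y
    rw [← smul_sub, norm_smul, Real.norm_of_nonneg hρ.le, fracKernel, fracKernel,
      ← ENNReal.ofReal_mul (by positivity), Real.mul_rpow hρ.le (norm_nonneg _),
      Real.rpow_neg hρ.le]
    congr 1
    simp only [one_div, mul_inv]
  have hb : ∀ x : EuclideanSpace ℝ (Fin n), ρ • x ∈ Metric.ball 0 ρ ↔ x ∈ Metric.ball 0 1 := by
    intro x
    rw [mem_ball_zero_iff, mem_ball_zero_iff, norm_smul, Real.norm_of_nonneg hρ.le,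
      mul_lt_iff_lt_one_right hρ]
  have h1 : ∀ x : EuclideanSpace ℝ (Fin n),
      (Metric.ball 0 ρ).indicator (1 : EuclideanSpace ℝ (Fin n) → ℝ≥0∞) (ρ • x) = (Metric.ball 0 1).indicator 1 x := by
    intro x
    by_cases h : x ∈ Metric.ball 0 1
    · rw [indicator_of_mem h, indicator_of_mem ((hb x).2 h), Pi.one_apply, Pi.one_apply]
    · rw [indicator_of_notMem h, indicator_of_notMem (mt (hb x).1 h)]
  have h2 : ∀ x : EuclideanSpace ℝ (Fin n),
      (Metric.ball 0 ρ)ᶜ.indicator (1 : EuclideanSpace ℝ (Fin n) → ℝ≥0∞) (ρ • x) = (Metric.ball 0 1)ᶜ.indicator 1 x := by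
    intro x
    by_cases h : x ∈ Metric.ball 0 1
    · rw [indicator_of_notMem (notMem_compl_iff.2 h),
        indicator_of_notMem (notMem_compl_iff.2 ((hb x).2 h))]
    · rw [indicator_of_mem (mem_compl h), indicator_of_mem (mem_compl (mt (hb x).1 h)),
        Pi.one_apply, Pi.one_apply]
  have h3 : ∀ x y : EuclideanSpace ℝ (Fin n),
      indicatorKernel (fracKernel n s) (Metric.ball 0 ρ) (Metric.ball 0 ρ)ᶜ (ρ • x) (ρ • y) =
      ENNReal.ofReal (ρ ^ (-((n : ℝ) + s))) *
        indicatorKernel (fracKernel n s) (Metric.ball 0 1) (Metric.ball 0 1)ᶜ x y := by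
    intro x y
    rw [indicatorKernel, indicatorKernel, h1, h2, hk]
    ring
  have h4 : ∀ x : EuclideanSpace ℝ (Fin n),
      ∫⁻ y, indicatorKernel (fracKernel n s) (Metric.ball 0 ρ) (Metric.ball 0 ρ)ᶜ (ρ • x) y =
      ENNReal.ofReal (ρ ^ n) * ENNReal.ofReal (ρ ^ (-((n : ℝ) + s))) *
      ∫⁻ y, indicatorKernel (fracKernel n s) (Metric.ball 0 1) (Metric.ball 0 1)ᶜ x y := by
    intro x
    rw [lintegral_comp_smul ((mF ρ).of_uncurry_left (x := ρ • x)) hρ, mul_assoc,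
      ← lintegral_const_mul _ ((mF 1).of_uncurry_left (x := x)), lintegral_congr (h3 x)]
  rw [fracPerimeter_eq_interaction, fracPerimeter_eq_interaction,
    interaction_eq_lintegral_indicatorKernel _ (mB _) (mB _).compl,
    interaction_eq_lintegral_indicatorKernel _ (mB _) (mB _).compl,
    lintegral_comp_smul (mF ρ).lintegral_prod_right hρ, lintegral_congr h4,
    lintegral_const_mul _ (mF 1).lintegral_prod_right, ← mul_assoc,
    ← ENNReal.ofReal_mul (by positivity), ← ENNReal.ofReal_mul (by positivity),
    ← Real.rpow_natCast, ← Real.rpow_add hρ, ← Real.rpow_add hρ]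
  congr 3
  ring

/-- Balls minimize the fractional perimeter at fixed volume. -/
theorem mul_volume_rpow_le_fracPerimeter (hn : 0 < n) {s : ℝ} (hs : 0 < s) (hs1 : s < 1)
    {E : Set (EuclideanSpace ℝ (Fin n))} (hE : MeasurableSet E) (hEtop : volume E ≠ ∞) :
    fracPerimeter s (Metric.ball (0 : EuclideanSpace ℝ (Fin n)) 1) *
        (volume E / volume (Metric.ball (0 : EuclideanSpace ℝ (Fin n)) 1)) ^ (((n : ℝ) - s) / n) ≤
      fracPerimeter s E := by
  have : Nonempty (Fin n) := ⟨⟨0, hn⟩⟩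
  have hn' : (0 : ℝ) < n := by exact_mod_cast hn
  have hn1 : (1 : ℝ) ≤ n := by exact_mod_cast hn
  set ω := volume (Metric.ball (0 : EuclideanSpace ℝ (Fin n)) 1) with hω
  have hω0 : ω ≠ 0 := (Metric.measure_ball_pos _ _ one_pos).ne'
  have hωtop : ω ≠ ∞ := measure_ball_lt_top.ne
  rcases eq_or_ne (volume E) 0 with h0 | h0
  · rw [h0, ENNReal.zero_div, ENNReal.zero_rpow_of_pos (by apply div_pos <;> linarith), mul_zero]
    exact zero_le
  set q : ℝ≥0∞ := volume E / ω with hq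
  have hq0 : q ≠ 0 := (ENNReal.div_pos h0 hωtop).ne'
  have hqtop : q ≠ ∞ := ENNReal.div_ne_top hEtop hω0
  set ρ : ℝ := q.toReal ^ (1 / (n : ℝ)) with hρ
  have hqr : 0 < q.toReal := ENNReal.toReal_pos hq0 hqtop
  have hρ0 : 0 < ρ := Real.rpow_pos_of_pos hqr _
  have hvol : volume (Metric.ball (0 : EuclideanSpace ℝ (Fin n)) ρ) = volume E := by
    rw [Measure.addHaar_ball_of_pos _ _ hρ0, finrank_euclideanSpace_fin, hρ, ← Real.rpow_natCast,
      ← Real.rpow_mul hqr.le, one_div, inv_mul_cancel₀ hn'.ne', Real.rpow_one,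
      ENNReal.ofReal_toReal hqtop, ← hω, hq, ENNReal.div_mul_cancel hω0 hωtop]
  have key := interaction_ball_compl_le_of_forall_lt (antitoneOn_fracKernel (n := n) hs)
    (fun _ => ENNReal.ofReal_ne_top) hE hvol
  rw [← fracPerimeter_eq_interaction, ← fracPerimeter_eq_interaction,
    fracPerimeter_ball s hρ0, mul_comm] at key
  refine le_trans (le_of_eq ?_) key
  congr 1
  rw [← ENNReal.ofReal_toReal hqtop, ENNReal.ofReal_rpow_of_pos hqr, hρ,
    ← Real.rpow_mul hqr.le]
  congr 2
  ring

lemma lintegral_fun_norm_annulus (hn : 0 < n) {f : ℝ → ℝ≥0∞} (hf : Measurable f) {a b : ℝ}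
    (ha : 0 ≤ a) :
    ∫⁻ x in {x : EuclideanSpace ℝ (Fin n) | ‖x‖ ∈ Ioo a b}, f ‖x‖ =
      sphereArea n * ∫⁻ r in Ioo a b, ENNReal.ofReal (r ^ (n - 1)) * f r := by
  have : Nonempty (Fin n) := ⟨⟨0, hn⟩⟩
  have mA : MeasurableSet {x : EuclideanSpace ℝ (Fin n) | ‖x‖ ∈ Ioo a b} :=
    measurable_norm measurableSet_Ioo
  rw [← lintegral_indicator mA]
  have h := lintegral_fun_norm (volume : Measure (EuclideanSpace ℝ (Fin n)))
    (hf.indicator (measurableSet_Ioo (a := a) (b := b)))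
  rw [finrank_euclideanSpace_fin] at h
  refine Eq.trans ?_ (h.trans ?_)
  · rfl
  rw [sphereArea]
  congr 1
  rw [← lintegral_indicator measurableSet_Ioi, ← lintegral_indicator measurableSet_Ioo]
  refine lintegral_congr fun r => ?_
  by_cases hr : r ∈ Ioo a b
  · rw [indicator_of_mem (mem_Ioi.2 (ha.trans_lt hr.1)), indicator_of_mem hr, indicator_of_mem hr]
  · rw [indicator_of_notMem hr]
    by_cases h : r ∈ Ioi (0 : ℝ) <;> simp [h, hr]

/-- A point `x` sees the complement at distance at least `1 - ‖x‖`, so its contribution is at most a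
constant times `(1 - ‖x‖)^(-s)`, integrable as `s < 1`. -/
lemma fracPerimeter_ball_one_ne_top (hn : 0 < n) {s : ℝ} (hs : 0 < s) (hs1 : s < 1) :
    fracPerimeter s (Metric.ball (0 : EuclideanSpace ℝ (Fin n)) 1) ≠ ∞ := by
  have : Nonempty (Fin n) := ⟨⟨0, hn⟩⟩
  have mw : Measurable fun r : ℝ => ENNReal.ofReal (1 - r) ^ (-s) := by fun_prop
  have mw' : Measurable fun x : EuclideanSpace ℝ (Fin n) => ENNReal.ofReal (1 - ‖x‖) ^ (-s) :=
    mw.comp measurable_norm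
  have hle : fracPerimeter s (Metric.ball (0 : EuclideanSpace ℝ (Fin n)) 1) ≤
      sphereArea n / ENNReal.ofReal s *
        (sphereArea n * ENNReal.ofReal ((1 - 0) ^ (1 - s) / (1 - s))) := by
    calc _ ≤ ∫⁻ x in Metric.ball (0 : EuclideanSpace ℝ (Fin n)) 1,
          sphereArea n / ENNReal.ofReal s * ENNReal.ofReal (1 - ‖x‖) ^ (-s) := by
          refine setLIntegral_mono' measurableSet_ball fun x hx => ?_
          refine lintegral_fracKernel_le hn hs ?_ x fun y hy => ?_
          · linarith [mem_ball_zero_iff.1 hx]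
          · have hy : 1 ≤ ‖y‖ := by simpa using hy
            linarith [norm_sub_norm_le y x, norm_sub_rev x y]
      _ = sphereArea n / ENNReal.ofReal s * ∫⁻ x in {x : EuclideanSpace ℝ (Fin n) | ‖x‖ ∈ Ioo 0 1},
          ENNReal.ofReal (1 - ‖x‖) ^ (-s) := by
          have e : Metric.ball (0 : EuclideanSpace ℝ (Fin n)) 1 =ᵐ[volume]
              {x : EuclideanSpace ℝ (Fin n) | ‖x‖ ∈ Ioo 0 1} := by
            filter_upwards [Measure.ae_ne volume (0 : EuclideanSpace ℝ (Fin n))] with x hx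
            have : 0 < ‖x‖ := norm_pos_iff.2 hx
            apply propext
            change x ∈ Metric.ball 0 1 ↔ 0 < ‖x‖ ∧ ‖x‖ < 1
            simp [this]
          rw [lintegral_const_mul _ mw', Measure.restrict_congr_set e]
      _ = sphereArea n / ENNReal.ofReal s * (sphereArea n * ∫⁻ r in Ioo (0 : ℝ) 1,
          ENNReal.ofReal (r ^ (n - 1)) * ENNReal.ofReal (1 - r) ^ (-s)) := by
          rw [lintegral_fun_norm_annulus hn mw le_rfl]
      _ ≤ _ := by
          rw [← lintegral_Ioo_sub_rpow hs1 zero_le_one]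
          refine mul_le_mul' le_rfl (mul_le_mul' le_rfl ?_)
          refine setLIntegral_mono' measurableSet_Ioo fun r hr => ?_
          rw [ENNReal.ofReal_rpow_of_pos (by linarith [hr.2])]
          refine mul_le_of_le_one_left zero_le ?_
          exact ENNReal.ofReal_le_one.2 (pow_le_one₀ hr.1.le hr.2.le)
  refine ne_top_of_le_ne_top ?_ hle
  have := sphereArea_ne_top n
  have h2 : ENNReal.ofReal s ≠ 0 := by simpa using hs
  exact ENNReal.mul_ne_top (ENNReal.div_ne_top this h2)
    (ENNReal.mul_ne_top this ENNReal.ofReal_ne_top)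

/-- The fractional perimeter of the unit ball blows up at least like `1 / (1 - s)`. -/
lemma le_fracPerimeter_ball_one (hn : 0 < n) {s : ℝ} (hs : 0 < s) (hs1 : s < 1) :
    volume (Metric.ball (0 : EuclideanSpace ℝ (Fin n)) 1) * ENNReal.ofReal ((3 ^ (n + 1))⁻¹) *
      (sphereArea n * ENNReal.ofReal ((2 ^ n)⁻¹ / (1 - s))) ≤
    fracPerimeter s (Metric.ball (0 : EuclideanSpace ℝ (Fin n)) 1) := by
  have : Nonempty (Fin n) := ⟨⟨0, hn⟩⟩
  set ω := volume (Metric.ball (0 : EuclideanSpace ℝ (Fin n)) 1) with hω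
  have mw : Measurable fun r : ℝ => ENNReal.ofReal ((1 - r) ^ (-s)) := by fun_prop
  have mw' : Measurable fun x : EuclideanSpace ℝ (Fin n) => ENNReal.ofReal ((1 - ‖x‖) ^ (-s)) :=
    mw.comp measurable_norm
  -- every point of the ball sees a ball of comparable radius outside
  have hx : ∀ x : EuclideanSpace ℝ (Fin n), ‖x‖ ∈ Ioo (1 / 2 : ℝ) 1 →
      ω * ENNReal.ofReal ((3 ^ (n + 1))⁻¹) * ENNReal.ofReal ((1 - ‖x‖) ^ (-s)) ≤
      ∫⁻ y in (Metric.ball (0 : EuclideanSpace ℝ (Fin n)) 1)ᶜ, fracKernel n s ‖x - y‖ := by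
    intro x hx
    have hx0 : 0 < ‖x‖ := by linarith [hx.1]
    set δ := 1 - ‖x‖ with hδ
    have hδ0 : 0 < δ := by linarith [hx.2]
    -- The mirror image of `x` in the unit sphere along its ray: the ball of radius `δ` about `z`
    -- avoids the unit ball and stays within `3 δ` of `x`.
    set z := (1 + 2 * δ / ‖x‖) • x with hz
    have hzn : ‖z‖ = 1 + δ := by
      rw [hz, norm_smul, Real.norm_of_nonneg (by positivity)]
      field_simp
      rw [hδ]
      ring
    have hxz : ‖x - z‖ = 2 * δ := by
      have : x - z = (-(2 * δ / ‖x‖)) • x := by rw [hz]; module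
      rw [this, norm_smul, norm_neg, Real.norm_of_nonneg (by positivity)]
      field_simp
    have hsub : Metric.ball z δ ⊆ (Metric.ball (0 : EuclideanSpace ℝ (Fin n)) 1)ᶜ := by
      intro y hy
      rw [mem_compl_iff, mem_ball_zero_iff, not_lt]
      have := norm_sub_norm_le z y
      rw [mem_ball_iff_norm, norm_sub_rev] at hy
      linarith
    calc _ = ∫⁻ _ in Metric.ball z δ, ENNReal.ofReal ((3 ^ (n + 1))⁻¹ * δ ^ (-((n : ℝ) + s))) := by
          rw [setLIntegral_const, Measure.addHaar_ball_of_pos _ _ hδ0, finrank_euclideanSpace_fin,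
            ← hω, mul_assoc, mul_comm ω, ← ENNReal.ofReal_mul (by positivity), ← mul_assoc,
            ← ENNReal.ofReal_mul (by positivity)]
          congr 2
          rw [mul_assoc]
          congr 1
          rw [← Real.rpow_natCast, ← Real.rpow_add hδ0]
          congr 1
          ring
      _ ≤ ∫⁻ y in Metric.ball z δ, fracKernel n s ‖x - y‖ := by
          refine setLIntegral_mono' measurableSet_ball fun y hy => ENNReal.ofReal_le_ofReal ?_
          have hy1 : 0 < ‖x - y‖ := by
            rw [norm_pos_iff, sub_ne_zero]
            rintro rfl
            rw [mem_ball_iff_norm, hxz] at hy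
            linarith
          have hy3 : ‖x - y‖ ≤ 3 * δ := by
            have := norm_sub_le_norm_sub_add_norm_sub x z y
            rw [mem_ball_iff_norm, norm_sub_rev] at hy
            linarith
          have h3 : ‖x - y‖ ^ ((n : ℝ) + s) ≤ 3 ^ (n + 1) * δ ^ ((n : ℝ) + s) := by
            calc _ ≤ (3 * δ) ^ ((n : ℝ) + s) := by gcongr
              _ = 3 ^ ((n : ℝ) + s) * δ ^ ((n : ℝ) + s) := Real.mul_rpow (by norm_num) hδ0.le
              _ ≤ 3 ^ ((n : ℝ) + 1) * δ ^ ((n : ℝ) + s) := by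
                gcongr
                norm_num
              _ = _ := by rw [← Real.rpow_natCast]; push_cast; rfl
          rw [Real.rpow_neg hδ0.le, ← mul_inv, one_div]
          gcongr
      _ ≤ _ := lintegral_mono_set hsub
  calc _ ≤ ω * ENNReal.ofReal ((3 ^ (n + 1))⁻¹) * (sphereArea n * ∫⁻ r in Ioo (1 / 2 : ℝ) 1,
        ENNReal.ofReal (r ^ (n - 1)) * ENNReal.ofReal ((1 - r) ^ (-s))) := by
        gcongr
        calc _ ≤ ∫⁻ r in Ioo (1 / 2 : ℝ) 1, ENNReal.ofReal ((1 / 2) ^ (n - 1)) *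
              ENNReal.ofReal ((1 - r) ^ (-s)) := by
              rw [lintegral_const_mul _ mw, lintegral_Ioo_sub_rpow hs1 (by norm_num),
                ← ENNReal.ofReal_mul (by positivity)]
              refine ENNReal.ofReal_le_ofReal ?_
              rw [mul_div_assoc']
              refine div_le_div_of_nonneg_right ?_ (by linarith)
              have h1 : ((1 : ℝ) / 2) ^ (1 : ℝ) ≤ (1 / 2) ^ (1 - s) :=
                Real.rpow_le_rpow_of_exponent_ge (by norm_num) (by norm_num) (by linarith)
              have e : ((2 : ℝ) ^ n)⁻¹ = (1 / 2) ^ (n - 1) * (1 / 2) ^ (1 : ℝ) := by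
                rw [Real.rpow_one, ← pow_succ, Nat.sub_add_cancel hn, one_div, inv_pow]
              rw [e, show (1 : ℝ) - 1 / 2 = 1 / 2 by norm_num]
              gcongr
          _ ≤ _ := by
              refine setLIntegral_mono' measurableSet_Ioo fun r hr => ?_
              have := hr.1
              gcongr
    _ = ∫⁻ x in {x : EuclideanSpace ℝ (Fin n) | ‖x‖ ∈ Ioo (1 / 2 : ℝ) 1},
        ω * ENNReal.ofReal ((3 ^ (n + 1))⁻¹) * ENNReal.ofReal ((1 - ‖x‖) ^ (-s)) := by
        rw [lintegral_const_mul _ mw',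
          lintegral_fun_norm_annulus hn mw (by norm_num)]
    _ ≤ ∫⁻ x in {x : EuclideanSpace ℝ (Fin n) | ‖x‖ ∈ Ioo (1 / 2 : ℝ) 1},
        ∫⁻ y in (Metric.ball (0 : EuclideanSpace ℝ (Fin n)) 1)ᶜ, fracKernel n s ‖x - y‖ :=
        setLIntegral_mono' (measurable_norm measurableSet_Ioo) hx
    _ ≤ _ := lintegral_mono_set fun x hx => mem_ball_zero_iff.2 hx.2

end

section

variable {n : ℕ}

/-! ### The perimeter of the unit ball -/

/-- The perimeter of the unit ball is at least `n |B|`: test with truncated radial fields. -/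
lemma sphereArea_le_perimeter_ball (n : ℕ) :
    sphereArea n ≤ perimeter (Metric.ball (0 : EuclideanSpace ℝ (Fin n)) 1) := by
  set B := Metric.ball (0 : EuclideanSpace ℝ (Fin n)) 1 with hB
  have key : ∀ c ∈ Ioo (0 : ℝ) 1, ENNReal.ofReal (c * (n * volume.real B)) ≤ perimeter B := by
    intro c hc
    -- The cutoff is `1` on the unit ball and vanishes from radius `1 / c` on, precisely where the
    -- field `c x` would exceed length one.
    let χ : ContDiffBump (0 : EuclideanSpace ℝ (Fin n)) :=
      ⟨1, 1 / c, one_pos, by rw [lt_div_iff₀ hc.1, one_mul]; exact hc.2⟩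
    let X : EuclideanSpace ℝ (Fin n) → EuclideanSpace ℝ (Fin n) := fun x => χ x • (c • x)
    have hX1 : ContDiff ℝ 1 X := χ.contDiff.smul (contDiff_const_smul c)
    have hXs : HasCompactSupport X := χ.hasCompactSupport.smul_right
    have hXb : ∀ x, ‖X x‖ ≤ 1 := by
      intro x
      by_cases hx : ‖x‖ < 1 / c
      · have h1 : ‖χ x‖ ≤ 1 := by
          rw [Real.norm_of_nonneg χ.nonneg]; exact χ.le_one
        have h2 : c * ‖x‖ ≤ 1 := by
          rw [lt_div_iff₀ hc.1] at hx
          linarith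
        calc ‖X x‖ = ‖χ x‖ * (c * ‖x‖) := by
              simp only [X, norm_smul, Real.norm_of_nonneg hc.1.le]
          _ ≤ 1 * 1 := by
              gcongr
              exact mul_nonneg hc.1.le (norm_nonneg x)
          _ = 1 := one_mul 1
      · have : χ x = 0 := χ.zero_of_le_dist (by rw [dist_zero_right]; exact not_lt.1 hx)
        simp [X, this]
    have hdiv : ∀ x ∈ B, divergence X x = c * n := by
      intro x hx
      have h1 : X =ᶠ[nhds x] fun x => c • x := by
        filter_upwards [Metric.isOpen_ball.mem_nhds hx] with y hy
        have : χ y = 1 := χ.one_of_mem_closedBall (Metric.ball_subset_closedBall hy)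
        simp [X, this]
      have h2 : fderiv ℝ X x = c • ContinuousLinearMap.id ℝ (EuclideanSpace ℝ (Fin n)) := by
        rw [h1.fderiv_eq]
        exact ((hasFDerivAt_id x).const_smul c).fderiv
      simp [divergence, h2, mul_comm]
    have hint : ∫ x in B, divergence X x = c * (n * volume.real B) := by
      rw [setIntegral_congr_fun measurableSet_ball hdiv, setIntegral_const, smul_eq_mul]
      ring
    rw [← hint]
    exact le_iSup_of_le X (le_iSup_of_le hX1 (le_iSup_of_le hXs (le_iSup_of_le hXb le_rfl)))
  have hlim : Filter.Tendsto (fun c : ℝ => ENNReal.ofReal (c * (n * volume.real B)))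
      (nhdsWithin 1 (Iio 1)) (nhds (ENNReal.ofReal (1 * (n * volume.real B)))) := by
    have : Continuous fun c : ℝ => ENNReal.ofReal (c * (n * volume.real B)) :=
      ENNReal.continuous_ofReal.comp (by fun_prop)
    exact (this.tendsto 1).mono_left nhdsWithin_le_nhds
  have h := le_of_tendsto hlim (by
    filter_upwards [Ioo_mem_nhdsLT (zero_lt_one' ℝ)] with c hc using key c hc)
  rwa [one_mul, ENNReal.ofReal_mul (Nat.cast_nonneg n), ENNReal.ofReal_natCast,
    ofReal_measureReal measure_ball_lt_top.ne] at h

/-- The shifted ball contains the concentric ball of radius `1 - h`, and Bernoulli's inequality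
bounds the volume of the remaining shell. -/
lemma volume_real_ball_diff_ball_le (x y : EuclideanSpace ℝ (Fin n)) {h : ℝ} (hh : ‖x - y‖ ≤ h)
    (h1 : h < 1) :
    volume.real (Metric.ball x 1 \ Metric.ball y 1) ≤
      n * h * volume.real (Metric.ball (0 : EuclideanSpace ℝ (Fin n)) 1) := by
  have hh0 : 0 ≤ h := (norm_nonneg _).trans hh
  have hsub : Metric.ball x 1 \ Metric.ball y 1 ⊆ Metric.ball x 1 \ Metric.ball x (1 - h) := by
    refine sdiff_subset_sdiff_right (Metric.ball_subset_ball' ?_)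
    rw [dist_eq_norm]
    linarith
  have hv : ∀ r : ℝ, 0 < r → volume.real (Metric.ball x r) =
      r ^ n * volume.real (Metric.ball (0 : EuclideanSpace ℝ (Fin n)) 1) := by
    intro r hr
    rw [measureReal_def, Measure.addHaar_ball_of_pos _ _ hr, finrank_euclideanSpace_fin,
      ENNReal.toReal_mul, ENNReal.toReal_ofReal (by positivity), measureReal_def]
  calc _ ≤ volume.real (Metric.ball x 1 \ Metric.ball x (1 - h)) :=
        measureReal_mono hsub (ne_top_of_le_ne_top measure_ball_lt_top.ne
          (measure_mono sdiff_subset))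
    _ = (1 - (1 + -h) ^ n) * volume.real (Metric.ball (0 : EuclideanSpace ℝ (Fin n)) 1) := by
        rw [measureReal_sdiff (Metric.ball_subset_ball (by linarith)) measurableSet_ball
          measure_ball_lt_top.ne, hv 1 one_pos, hv (1 - h) (by linarith), one_pow, ← sub_eq_add_neg]
        ring
    _ ≤ _ := by
        have := one_add_mul_le_pow (a := -h) (by linarith) n
        gcongr
        linarith

lemma abs_setIntegral_ball_sub_le {f : EuclideanSpace ℝ (Fin n) → ℝ} (hf : Continuous f)
    (hfs : HasCompactSupport f) (hf1 : ∀ x, ‖f x‖ ≤ 1) (x y : EuclideanSpace ℝ (Fin n))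
    (hxy : ‖x - y‖ < 1) :
    ‖(∫ z in Metric.ball x 1, f z) - ∫ z in Metric.ball y 1, f z‖ ≤
      2 * n * volume.real (Metric.ball (0 : EuclideanSpace ℝ (Fin n)) 1) * ‖x - y‖ := by
  have hi := hf.integrable_of_hasCompactSupport (μ := volume) hfs
  have hfin : ∀ a b : EuclideanSpace ℝ (Fin n),
      volume (Metric.ball a 1 \ Metric.ball b 1) < ∞ := fun a b =>
    (measure_mono sdiff_subset).trans_lt measure_ball_lt_top
  rw [← integral_inter_add_sdiff (measurableSet_ball (x := y) (ε := 1)) hi.integrableOn,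
    ← integral_inter_add_sdiff (s := Metric.ball y 1) (measurableSet_ball (x := x) (ε := 1))
      hi.integrableOn, inter_comm, add_sub_add_left_eq_sub]
  refine (norm_sub_le _ _).trans ?_
  have h1 := (norm_setIntegral_le_of_norm_le_const (hfin x y) fun z _ => hf1 z).trans
    ((one_mul _).trans_le (volume_real_ball_diff_ball_le x y le_rfl hxy))
  have h2 := (norm_setIntegral_le_of_norm_le_const (hfin y x) fun z _ => hf1 z).trans
    ((one_mul _).trans_le (volume_real_ball_diff_ball_le y x (norm_sub_rev x y).ge hxy))
  linarith

/-- The integral of a directional derivative over the ball is the derivative of the integral of `f`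
over translated balls, which is Lipschitz in the translation. This does the work of the divergence
theorem. -/
lemma abs_setIntegral_ball_deriv_le {f f' : EuclideanSpace ℝ (Fin n) → ℝ} (hf : Continuous f)
    (hfs : HasCompactSupport f) (hf1 : ∀ x, ‖f x‖ ≤ 1) (hf' : Continuous f')
    (hfs' : HasCompactSupport f') {v : EuclideanSpace ℝ (Fin n)} (hv : ‖v‖ = 1)
    (hd : ∀ x (h : ℝ), HasDerivAt (fun h : ℝ => f (x + h • v)) (f' (x + h • v)) h) :
    ‖∫ x in Metric.ball 0 1, f' x‖ ≤
      2 * n * volume.real (Metric.ball (0 : EuclideanSpace ℝ (Fin n)) 1) := by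
  obtain ⟨M, hM⟩ := hfs'.exists_bound_of_continuous hf'
  have hi := hf.integrable_of_hasCompactSupport (μ := volume) hfs
  have hshift : ∀ h : ℝ, ∫ x in Metric.ball (0 : EuclideanSpace ℝ (Fin n)) 1, f (x + h • v) =
      ∫ x in Metric.ball (h • v) 1, f x := by
    intro h
    have := (measurePreserving_add_right volume (h • v)).setIntegral_preimage_emb
      (measurableEmbedding_addRight (h • v)) f (Metric.ball (h • v) 1)
    rw [← this]
    congr 2
    ext x
    simp [dist_eq_norm]
  have hfinite : IsFiniteMeasure
      (volume.restrict (Metric.ball (0 : EuclideanSpace ℝ (Fin n)) 1)) :=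
    ⟨by rw [Measure.restrict_apply_univ]; exact measure_ball_lt_top⟩
  have hder := (hasDerivAt_integral_of_dominated_loc_of_deriv_le
    (μ := volume.restrict (Metric.ball (0 : EuclideanSpace ℝ (Fin n)) 1))
    (F := fun h x => f (x + h • v)) (F' := fun h x => f' (x + h • v)) (x₀ := (0 : ℝ))
    (bound := fun _ => M) (s := univ)
    Filter.univ_mem
    (Filter.Eventually.of_forall fun h =>
      (hf.comp (by fun_prop : Continuous fun x => x + h • v)).aestronglyMeasurable)
    (by simp only [zero_smul, add_zero]; exact hi.integrableOn)
    (hf'.comp (by fun_prop : Continuous fun x => x + (0 : ℝ) • v)).aestronglyMeasurable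
    (Filter.Eventually.of_forall fun x h _ => hM _)
    (integrable_const M)
    (Filter.Eventually.of_forall fun x h _ => hd x h)).2
  simp only [zero_smul, add_zero] at hder
  refine hder.le_of_lip' (by positivity) ?_
  filter_upwards [Metric.ball_mem_nhds (0 : ℝ) one_pos] with h hh
  have hhv : ‖h • v - 0‖ = ‖h‖ := by rw [sub_zero, norm_smul, hv, mul_one]
  have hh1 : ‖h‖ < 1 := by simpa using hh
  have := abs_setIntegral_ball_sub_le hf hfs hf1 (h • v) 0 (by rwa [hhv])
  rw [hhv] at this
  rw [hshift, hshift, zero_smul, sub_zero]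
  exact this

/-- The bound, obtained by summing over coordinates, is crude; only finiteness is used, so that
`ballPerimeter` is the true perimeter. -/
lemma perimeter_ball_ne_top (n : ℕ) :
    perimeter (Metric.ball (0 : EuclideanSpace ℝ (Fin n)) 1) ≠ ∞ := by
  refine ne_top_of_le_ne_top (b := ENNReal.ofReal
    (n * (2 * n * volume.real (Metric.ball (0 : EuclideanSpace ℝ (Fin n)) 1))))
    ENNReal.ofReal_ne_top ?_
  refine iSup_le fun X => iSup_le fun hX => iSup_le fun hXs => iSup_le fun hXb =>
    ENNReal.ofReal_le_ofReal ?_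
  have hc : ∀ i, Continuous fun x => (fderiv ℝ X x (EuclideanSpace.single i (1 : ℝ))) i :=
    fun i => (EuclideanSpace.proj (𝕜 := ℝ) i).continuous.comp
      ((hX.continuous_fderiv one_ne_zero).clm_apply continuous_const)
  have hs : ∀ i, HasCompactSupport
      fun x => (fderiv ℝ X x (EuclideanSpace.single i (1 : ℝ))) i := fun i =>
    (hXs.fderiv_apply ℝ (EuclideanSpace.single i (1 : ℝ))).comp_left
      (g := fun x : EuclideanSpace ℝ (Fin n) => x i) rfl
  unfold divergence
  rw [integral_finsetSum _ fun i _ =>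
    ((hc i).integrable_of_hasCompactSupport (hs i)).integrableOn]
  calc _ ≤ ∑ _i : Fin n, 2 * n * volume.real (Metric.ball (0 : EuclideanSpace ℝ (Fin n)) 1) := by
        refine Finset.sum_le_sum fun i _ => (le_abs_self _).trans ?_
        refine abs_setIntegral_ball_deriv_le (f := fun x => X x i)
          (v := EuclideanSpace.single i (1 : ℝ))
          ((EuclideanSpace.proj (𝕜 := ℝ) i).continuous.comp hX.continuous)
          (hXs.comp_left (g := fun x : EuclideanSpace ℝ (Fin n) => x i) rfl)
          (fun x => (PiLp.norm_apply_le (X x) i).trans (hXb x)) (hc i) (hs i) (by simp)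
          fun x h => ?_
        have h1 : HasDerivAt (fun h : ℝ => x + h • EuclideanSpace.single i (1 : ℝ))
            (EuclideanSpace.single i (1 : ℝ)) h := by
          simpa using ((hasDerivAt_id h).smul_const (EuclideanSpace.single i (1 : ℝ))).const_add x
        have h2 := ((hX.differentiable one_ne_zero)
          (x + h • EuclideanSpace.single i (1 : ℝ))).hasFDerivAt.comp_hasDerivAt h h1
        exact (EuclideanSpace.proj (𝕜 := ℝ) i).hasFDerivAt.comp_hasDerivAt h h2
    _ = _ := by simp

end

section

variable {n : ℕ}

/-! ### Decay of the mass outside balls -/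

/-- The interaction of the parts of `E` outside and inside a ball. -/
lemma interaction_diff_inter_ball_le (hn : 0 < n) {s : ℝ} (hs : 0 < s)
    {E : Set (EuclideanSpace ℝ (Fin n))} (hE : MeasurableSet E) (r : ℝ) :
    interaction (fracKernel n s) (E \ Metric.ball 0 r) (E ∩ Metric.ball 0 r) ≤
      sphereArea n / ENNReal.ofReal s *
        ∫⁻ x in E \ Metric.ball 0 r, ENNReal.ofReal (‖x‖ - r) ^ (-s) := by
  have mw : Measurable fun x : EuclideanSpace ℝ (Fin n) => ENNReal.ofReal (‖x‖ - r) ^ (-s) := by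
    fun_prop
  rw [← lintegral_const_mul _ mw]
  refine setLIntegral_mono' (hE.diff measurableSet_ball) fun x hx => ?_
  have hx2 : r ≤ ‖x‖ := by
    have := hx.2
    rwa [mem_ball_zero_iff, not_lt] at this
  refine lintegral_fracKernel_le hn hs (by linarith) x fun y hy => ?_
  have := mem_ball_zero_iff.1 hy.2
  linarith [norm_sub_norm_le x y]

/-- After exchanging the integrals, each fixed `x` sees a one-dimensional singularity in `r` at
`‖x‖`, integrable since `s < 1`. -/
lemma lintegral_Ioo_lintegral_diff_ball_le {s : ℝ} (hs : 0 < s) (hs1 : s < 1)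
    {E : Set (EuclideanSpace ℝ (Fin n))} (hE : MeasurableSet E) {a b : ℝ} (hab : a ≤ b) :
    ∫⁻ r in Ioo a b, ∫⁻ x in E \ Metric.ball 0 r, ENNReal.ofReal (‖x‖ - r) ^ (-s) ≤
      ENNReal.ofReal ((b - a) ^ (1 - s) / (1 - s)) * volume (E \ Metric.ball 0 a) := by
  let F : ℝ → EuclideanSpace ℝ (Fin n) → ℝ≥0∞ := fun r x =>
    (Iic ‖x‖).indicator (fun r => ENNReal.ofReal (‖x‖ - r) ^ (-s)) r
  have mF : Measurable F.uncurry := by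
    have h1 : MeasurableSet {p : ℝ × EuclideanSpace ℝ (Fin n) | p.1 ≤ ‖p.2‖} :=
      measurableSet_le measurable_fst measurable_snd.norm
    have h2 : Measurable fun p : ℝ × EuclideanSpace ℝ (Fin n) =>
        ENNReal.ofReal (‖p.2‖ - p.1) ^ (-s) := by fun_prop
    exact h2.indicator h1
  calc _ ≤ ∫⁻ r in Ioo a b, ∫⁻ x in E \ Metric.ball 0 a, F r x := by
        refine setLIntegral_mono' measurableSet_Ioo fun r hr => ?_
        rw [← lintegral_indicator (hE.diff measurableSet_ball),
          ← lintegral_indicator (hE.diff measurableSet_ball)]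
        refine lintegral_mono fun x => ?_
        by_cases hx : x ∈ E \ Metric.ball 0 r
        · have hx2 : r ≤ ‖x‖ := by
            have := hx.2
            rwa [mem_ball_zero_iff, not_lt] at this
          have hxa : x ∈ E \ Metric.ball 0 a :=
            ⟨hx.1, fun h => hx.2 (Metric.ball_subset_ball hr.1.le h)⟩
          rw [indicator_of_mem hx, indicator_of_mem hxa]
          exact (indicator_of_mem (mem_Iic.2 hx2)
            (fun r => ENNReal.ofReal (‖x‖ - r) ^ (-s))).ge
        · rw [indicator_of_notMem hx]
          exact zero_le
    _ = ∫⁻ x in E \ Metric.ball 0 a, ∫⁻ r in Ioo a b, F r x :=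
        lintegral_lintegral_swap mF.aemeasurable
    _ ≤ ∫⁻ _ in E \ Metric.ball 0 a, ENNReal.ofReal ((b - a) ^ (1 - s) / (1 - s)) :=
        lintegral_mono fun x => lintegral_Ioo_inter_Iic_rpow_le hs hs1 hab
    _ = _ := setLIntegral_const _ _

/-- If a ball cannot be cut off profitably, the mass outside it is controlled by the interaction
with the inside. -/
lemma ofReal_le_interaction_of_lt (hn : 0 < n) {s : ℝ} (hs : 0 < s) (hs1 : s < 1)
    {E : Set (EuclideanSpace ℝ (Fin n))} (hE : MeasurableSet E) {r : ℝ} {Y : ℝ≥0∞}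
    (hfin : volume (E \ Metric.ball 0 r) ≠ ∞)
    (hY : Y + Y ≤ fracPerimeter s (Metric.ball (0 : EuclideanSpace ℝ (Fin n)) 1) *
        (volume (E \ Metric.ball 0 r) / volume (Metric.ball (0 : EuclideanSpace ℝ (Fin n)) 1)) ^
          (((n : ℝ) - s) / n))
    (hYtop : Y ≠ ∞)
    (hlt : fracPerimeter s E < fracPerimeter s (E ∩ Metric.ball 0 r) + Y) :
    Y ≤ 2 * interaction (fracKernel n s) (E \ Metric.ball 0 r) (E ∩ Metric.ball 0 r) := by
  set I := interaction (fracKernel n s) (E \ Metric.ball 0 r) (E ∩ Metric.ball 0 r) with hI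
  -- The energies are cancelled below, which needs them finite; an infinite interaction is the
  -- trivial case.
  rcases eq_or_ne I ∞ with hItop | hItop
  · rw [hItop, ENNReal.mul_top two_ne_zero]
    exact le_top
  have hsplit := interaction_compl_inter_add_diff (measurable_fracKernel n s) hE
    (measurableSet_ball (x := (0 : EuclideanSpace ℝ (Fin n))) (ε := r))
  rw [← fracPerimeter_eq_interaction, ← fracPerimeter_eq_interaction,
    ← fracPerimeter_eq_interaction, ← hI] at hsplit
  have hiso := mul_volume_rpow_le_fracPerimeter hn hs hs1 (hE.diff measurableSet_ball) hfin
  have h1 : fracPerimeter s (E ∩ Metric.ball 0 r) ≠ ∞ := by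
    refine ne_top_of_le_ne_top ?_ (le_self_add.trans_eq hsplit)
    exact ENNReal.add_ne_top.2 ⟨hlt.ne_top, ENNReal.mul_ne_top ENNReal.ofNat_ne_top hItop⟩
  have h2 : fracPerimeter s (E ∩ Metric.ball 0 r) + (Y + Y) ≤
      fracPerimeter s (E ∩ Metric.ball 0 r) + (Y + 2 * I) := by
    calc _ ≤ fracPerimeter s (E ∩ Metric.ball 0 r) + fracPerimeter s (E \ Metric.ball 0 r) := by
          gcongr
          exact hY.trans hiso
      _ = fracPerimeter s E + 2 * I := hsplit
      _ ≤ fracPerimeter s (E ∩ Metric.ball 0 r) + Y + 2 * I := by gcongr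
      _ = _ := add_assoc _ _ _
  exact (ENNReal.add_le_add_iff_left hYtop).1 ((ENNReal.add_le_add_iff_left h1).1 h2)

/-- The iteration: a nonlinear decay estimate forces `w` to vanish after a finite distance. -/
lemma eq_zero_of_decay {d s M η L : ℝ} (hs : 0 < s) (hsd : s < d) (hM : 0 < M) (hη : 0 < η)
    (hL : 0 < L) (hLs : L ^ s = 2 ^ d * M * η ^ (s / d)) {w : ℝ → ℝ} (hw : ∀ r, 0 ≤ w r)
    (hmono : Antitone w) (h1 : w 1 ≤ η)
    (hstep : ∀ a b, 1 ≤ a → a < b → b ≤ 1 + L →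
      w b ^ ((d - s) / d) ≤ M * (b - a) ^ (-s) * w a) :
    w (1 + L) = 0 := by
  have hd : 0 < d := hs.trans hsd
  have hα : 0 < (d - s) / d := div_pos (by linarith) hd
  have key : ∀ k : ℕ, w (1 + L * (1 - (1 / 2) ^ k)) ≤ η * ((1 / 2) ^ k) ^ d := by
    intro k
    induction k with
    | zero => simpa using h1
    | succ k ih =>
      set q : ℝ := (1 / 2) ^ k with hq
      have hq0 : 0 < q := by positivity
      have hq1 : q ≤ 1 := pow_le_one₀ (by norm_num) (by norm_num)
      have hqs : (1 / 2 : ℝ) ^ (k + 1) = q / 2 := by rw [pow_succ]; ring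
      rw [hqs]
      have hst := hstep (1 + L * (1 - q)) (1 + L * (1 - q / 2))
        (by nlinarith) (by nlinarith) (by nlinarith)
      rw [show 1 + L * (1 - q / 2) - (1 + L * (1 - q)) = L * (q / 2) by ring] at hst
      have hq2 : (0 : ℝ) < q / 2 := by positivity
      -- `hLs` is the choice of `L` for which the bound `η q^d` reproduces itself exactly when `q`
      -- is halved.
      have e1 : M * (L * (q / 2)) ^ (-s) * (η * q ^ d) = (η * (q / 2) ^ d) ^ ((d - s) / d) := by
        rw [Real.mul_rpow hη.le (by positivity), ← Real.rpow_mul hq2.le,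
          show d * ((d - s) / d) = d - s by field_simp, Real.mul_rpow hL.le hq2.le,
          Real.rpow_neg hL.le, hLs, Real.rpow_neg hq2.le, Real.rpow_sub hq2,
          Real.div_rpow hq0.le (by norm_num) d,
          show (d - s) / d = 1 - s / d by field_simp, Real.rpow_sub hη, Real.rpow_one]
        have : (0 : ℝ) < 2 ^ d := by positivity
        have : (0 : ℝ) < η ^ (s / d) := by positivity
        have : (0 : ℝ) < (q / 2) ^ s := by positivity
        field_simp
      have h2 : w (1 + L * (1 - q / 2)) ^ ((d - s) / d) ≤ (η * (q / 2) ^ d) ^ ((d - s) / d) := by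
        rw [← e1]
        refine hst.trans ?_
        gcongr
      exact (Real.rpow_le_rpow_iff (hw _) (by positivity) hα).1 h2
  refine le_antisymm ?_ (hw _)
  have hlim : Filter.Tendsto (fun k : ℕ => η * (((1 : ℝ) / 2) ^ k) ^ d) Filter.atTop
      (nhds (η * 0 ^ d)) :=
    ((tendsto_pow_atTop_nhds_zero_of_lt_one (by norm_num) (by norm_num)).rpow_const
      (.inr hd.le)).const_mul η
  rw [Real.zero_rpow hd.ne', mul_zero] at hlim
  refine ge_of_tendsto' hlim fun k => (hmono ?_).trans (key k)
  have : (0 : ℝ) < (1 / 2) ^ k := by positivity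
  nlinarith

end

section

variable {n : ℕ}

/-! ### The constants -/

lemma ofReal_ballVolume (n : ℕ) :
    ENNReal.ofReal (ballVolume n) = volume (Metric.ball (0 : EuclideanSpace ℝ (Fin n)) 1) := by
  rw [ballVolume, oball_eq_ball, ENNReal.ofReal_toReal measure_ball_lt_top.ne]

lemma ballVolume_pos (n : ℕ) : 0 < ballVolume n := by
  rw [ballVolume, oball_eq_ball]
  exact ENNReal.toReal_pos (Metric.measure_ball_pos _ _ one_pos).ne' measure_ball_lt_top.ne

lemma ofReal_mul_ballVolume (n : ℕ) : ENNReal.ofReal (n * ballVolume n) = sphereArea n := by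
  rw [ENNReal.ofReal_mul (Nat.cast_nonneg n), ENNReal.ofReal_natCast, ofReal_ballVolume, sphereArea]

lemma mul_ballVolume_le_ballPerimeter (n : ℕ) : n * ballVolume n ≤ ballPerimeter n := by
  rw [ballPerimeter, oball_eq_ball, ← ENNReal.ofReal_le_iff_le_toReal (perimeter_ball_ne_top n),
    ofReal_mul_ballVolume]
  exact sphereArea_le_perimeter_ball n

lemma ballPerimeter_pos (hn : 0 < n) : 0 < ballPerimeter n := by
  have hn' : (0 : ℝ) < n := by exact_mod_cast hn
  exact (mul_pos hn' (ballVolume_pos n)).trans_le (mul_ballVolume_le_ballPerimeter n)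

lemma ofReal_ballFracPerimeter (hn : 0 < n) {s : ℝ} (hs : 0 < s) (hs1 : s < 1) :
    ENNReal.ofReal (ballFracPerimeter n s) =
      fracPerimeter s (Metric.ball (0 : EuclideanSpace ℝ (Fin n)) 1) := by
  rw [ballFracPerimeter, oball_eq_ball,
    ENNReal.ofReal_toReal (fracPerimeter_ball_one_ne_top hn hs hs1)]

lemma ballFracPerimeter_nonneg (n : ℕ) (s : ℝ) : 0 ≤ ballFracPerimeter n s :=
  ENNReal.toReal_nonneg

/-- A lower bound for `(1 - s) P_s(B)` that does not depend on `s`. -/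
def fracPerimeterLowerBound (n : ℕ) : ℝ :=
  ballVolume n * (3 ^ (n + 1))⁻¹ * (n * ballVolume n * (2 ^ n)⁻¹)

lemma fracPerimeterLowerBound_pos (hn : 0 < n) : 0 < fracPerimeterLowerBound n := by
  have := ballVolume_pos n
  have hn' : (0 : ℝ) < n := by exact_mod_cast hn
  unfold fracPerimeterLowerBound
  positivity

lemma fracPerimeterLowerBound_le (hn : 0 < n) {s : ℝ} (hs : 0 < s) (hs1 : s < 1) :
    fracPerimeterLowerBound n ≤ (1 - s) * ballFracPerimeter n s := by
  have h := le_fracPerimeter_ball_one hn hs hs1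
  have hω := (ballVolume_pos n).le
  have h1 : 0 < 1 - s := by linarith
  rw [← ofReal_ballVolume, ← ofReal_mul_ballVolume, ← ENNReal.ofReal_mul hω,
    ← ENNReal.ofReal_mul (by positivity), ← ENNReal.ofReal_mul (by positivity),
    ← ofReal_ballFracPerimeter hn hs hs1, 
    ENNReal.ofReal_le_ofReal_iff (ballFracPerimeter_nonneg n s)] at h
  calc fracPerimeterLowerBound n = (1 - s) * (ballVolume n * (3 ^ (n + 1))⁻¹ *
        (n * ballVolume n * ((2 ^ n)⁻¹ / (1 - s)))) := by
        unfold fracPerimeterLowerBound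
        field_simp
    _ ≤ _ := by gcongr

lemma ballFracPerimeter_pos (hn : 0 < n) {s : ℝ} (hs : 0 < s) (hs1 : s < 1) :
    0 < ballFracPerimeter n s :=
  pos_of_mul_pos_right ((fracPerimeterLowerBound_pos hn).trans_le
    (fracPerimeterLowerBound_le hn hs hs1)) (by linarith)

/-- The base of the power `1 / s` in the constant `C₁`. -/
def decayConstant (n : ℕ) (s : ℝ) : ℝ :=
  4 * ballVolume n ^ (((n : ℝ) - s) / (n : ℝ)) * ballPerimeter n /
    (s * (1 - s) * ballFracPerimeter n s)

lemma C₁_eq (n : ℕ) {s : ℝ} (hs : s ≠ 0) :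
    C₁ n s = 2 ^ ((n : ℝ) / s) * decayConstant n s ^ (1 / s) := by
  rw [C₁, decayConstant]
  congr 2
  field_simp
  ring

lemma decayConstant_pos (hn : 0 < n) {s : ℝ} (hs : 0 < s) (hs1 : s < 1) :
    0 < decayConstant n s := by
  have h1 := ballVolume_pos n
  have h2 := ballPerimeter_pos hn
  have h3 := ballFracPerimeter_pos hn hs hs1
  have h4 : 0 < 1 - s := by linarith
  unfold decayConstant
  positivity

lemma C₁_pos (hn : 0 < n) {s : ℝ} (hs : 0 < s) (hs1 : s < 1) : 0 < C₁ n s := by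
  have := decayConstant_pos hn hs hs1
  rw [C₁_eq n hs.ne']
  positivity

lemma C₂_pos (hn : 0 < n) {s : ℝ} (hs : 0 < s) (hs1 : s < 1) : 0 < C₂ n s := by
  have h1 := ballVolume_pos n
  have h3 := ballFracPerimeter_pos hn hs hs1
  have h4 : 0 < 1 - s := by linarith
  unfold C₂
  positivity

lemma bddAbove_C₁_add_C₂ (hn : 0 < n) {s₀ : ℝ} (hs₀ : 0 < s₀) :
    BddAbove ((fun s : ℝ => C₁ n s + C₂ n s) '' Ico s₀ 1) := by
  have hc := fracPerimeterLowerBound_pos hn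
  have hP := ballPerimeter_pos hn
  have hω := ballVolume_pos n
  have hn' : (1 : ℝ) ≤ n := by exact_mod_cast hn
  -- Bases at least one make the powers monotone in the exponent, so the exponents can be replaced
  -- by their extreme values.
  set m := max 1 (ballVolume n) with hm
  have hm1 : 1 ≤ m := le_max_left _ _
  set A := max 1 (4 * m * ballPerimeter n / (s₀ * fracPerimeterLowerBound n)) with hA
  have hA1 : 1 ≤ A := le_max_left _ _
  refine ⟨2 ^ ((n : ℝ) / s₀) * A ^ (1 / s₀) + 2 * m / fracPerimeterLowerBound n, ?_⟩
  rintro _ ⟨s, ⟨hs, hs1⟩, rfl⟩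
  have hs0 : 0 < s := hs₀.trans_le hs
  have hlow := fracPerimeterLowerBound_le hn hs0 hs1
  have hpow : ballVolume n ^ (((n : ℝ) - s) / (n : ℝ)) ≤ m := by
    have h0 : 0 ≤ ((n : ℝ) - s) / (n : ℝ) := div_nonneg (by linarith) (by linarith)
    calc _ ≤ m ^ (((n : ℝ) - s) / (n : ℝ)) := by
          gcongr
          exact le_max_right _ _
      _ ≤ m ^ (1 : ℝ) := by
          refine Real.rpow_le_rpow_of_exponent_le hm1 ?_
          rw [div_le_one (by linarith)]
          linarith
      _ = m := Real.rpow_one m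
  have hD : decayConstant n s ≤ A := by
    refine le_trans ?_ (le_max_right _ _)
    unfold decayConstant
    rw [mul_assoc s]
    gcongr
  have h1 : C₁ n s ≤ 2 ^ ((n : ℝ) / s₀) * A ^ (1 / s₀) := by
    rw [C₁_eq n hs0.ne']
    have := (decayConstant_pos hn hs0 hs1).le
    have h2 : decayConstant n s ^ (1 / s) ≤ A ^ (1 / s₀) :=
      (Real.rpow_le_rpow this hD (by positivity)).trans
        (Real.rpow_le_rpow_of_exponent_le hA1 (by gcongr))
    have h3 : (2 : ℝ) ^ ((n : ℝ) / s) ≤ 2 ^ ((n : ℝ) / s₀) :=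
      Real.rpow_le_rpow_of_exponent_le one_le_two (by gcongr)
    gcongr
  have h2 : C₂ n s ≤ 2 * m / fracPerimeterLowerBound n := by
    unfold C₂
    gcongr
  exact add_le_add h1 h2

/-! ### The truncation radius -/

lemma fracPerimeter_congr_set (s : ℝ) {E F : Set (EuclideanSpace ℝ (Fin n))}
    (h : E =ᵐ[volume] F) : fracPerimeter s E = fracPerimeter s F := by
  rw [fracPerimeter_eq_interaction, fracPerimeter_eq_interaction]
  exact interaction_congr_set _ h h.compl

/-- A ball that contains almost all of `E` can be cut off for free. -/
lemma truncation_le_of_volume_diff_eq_zero (s : ℝ) {E : Set (EuclideanSpace ℝ (Fin n))} {r : ℝ}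
    (h : volume (E \ Metric.ball 0 r) = 0) (q : ℝ≥0∞) :
    ENNReal.ofReal (1 - s) * fracPerimeter s (E ∩ Metric.ball 0 r) +
      volume (E \ Metric.ball 0 r) / q ≤ ENNReal.ofReal (1 - s) * fracPerimeter s E := by
  have he : E ∩ Metric.ball 0 r = E \ (E \ Metric.ball 0 r) := by
    ext x
    simp
  rw [h, ENNReal.zero_div, add_zero, he,
    fracPerimeter_congr_set s (sdiff_null_ae_eq_self (s := E) h)]

/-- The decay estimate at radii where cutting off is not profitable. -/
lemma decay_of_not_truncation (hn : 0 < n) {s : ℝ} (hs : 0 < s) (hs1 : s < 1)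
    {E : Set (EuclideanSpace ℝ (Fin n))} (hE : MeasurableSet E) {η : ℝ} (hη : 0 < η) {a b : ℝ}
    (ha : volume (E \ Metric.ball 0 a) ≤ ENNReal.ofReal η) (hab : a < b)
    (hlt : ∀ r ∈ Ioo a b, ENNReal.ofReal (1 - s) * fracPerimeter s E <
      ENNReal.ofReal (1 - s) * fracPerimeter s (E ∩ Metric.ball 0 r) +
        volume (E \ Metric.ball 0 r) / ENNReal.ofReal (C₂ n s * η ^ (s / (n : ℝ)))) :
    volume.real (E \ Metric.ball 0 b) ^ (((n : ℝ) - s) / n) ≤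
      decayConstant n s * (b - a) ^ (-s) * volume.real (E \ Metric.ball 0 a) := by
  have hn1 : (1 : ℝ) ≤ n := by exact_mod_cast hn
  have hn0 : (0 : ℝ) < n := by linarith
  set α := ((n : ℝ) - s) / n with hα
  have hα0 : 0 < α := div_pos (by linarith) hn0
  have hω := ballVolume_pos n
  have hP := ballFracPerimeter_pos hn hs hs1
  have hs1' : 0 < 1 - s := by linarith
  have hC₂ := C₂_pos hn hs hs1
  set c := ballFracPerimeter n s / ballVolume n ^ α with hc
  have hc0 : 0 < c := by positivity
  -- `c` is the isoperimetric constant, and the factor `2` reserves half of the isoperimetric bound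
  -- for the interaction.
  have hC₂c : C₂ n s = 2 / ((1 - s) * c) := by
    rw [C₂, ← hα, hc]
    field_simp
  have hatop : volume (E \ Metric.ball 0 a) ≠ ∞ := ne_top_of_le_ne_top ENNReal.ofReal_ne_top ha
  set w : ℝ → ℝ := fun r => volume.real (E \ Metric.ball 0 r) with hw
  have hw0 : ∀ r, 0 ≤ w r := fun r => measureReal_nonneg
  have hle : ∀ r, a ≤ r → volume (E \ Metric.ball 0 r) ≤ volume (E \ Metric.ball 0 a) :=
    fun r hr => measure_mono (sdiff_subset_sdiff_right (Metric.ball_subset_ball hr))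
  have htop : ∀ r, a ≤ r → volume (E \ Metric.ball 0 r) ≠ ∞ :=
    fun r hr => ne_top_of_le_ne_top hatop (hle r hr)
  have hofReal : ∀ r, a ≤ r → ENNReal.ofReal (w r) = volume (E \ Metric.ball 0 r) :=
    fun r hr => ENNReal.ofReal_toReal (htop r hr)
  have hwη : ∀ r, a ≤ r → w r ≤ η := fun r hr =>
    ENNReal.toReal_le_of_le_ofReal hη.le ((hle r hr).trans ha)
  have hpt : ∀ r ∈ Ioo a b, ENNReal.ofReal (c / 2 * w b ^ α) ≤
      2 * (sphereArea n / ENNReal.ofReal s) *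
        ∫⁻ x in E \ Metric.ball 0 r, ENNReal.ofReal (‖x‖ - r) ^ (-s) := by
    intro r hr
    have har := hr.1.le
    have hbr : w b ≤ w r := measureReal_mono
      (sdiff_subset_sdiff_right (Metric.ball_subset_ball hr.2.le)) (htop r har)
    calc _ ≤ ENNReal.ofReal (c / 2 * w r ^ α) := by
          refine ENNReal.ofReal_le_ofReal ?_
          have := hw0 b
          gcongr
      _ ≤ 2 * interaction (fracKernel n s) (E \ Metric.ball 0 r) (E ∩ Metric.ball 0 r) := by
          refine ofReal_le_interaction_of_lt hn hs hs1 hE (htop r har) (le_of_eq ?_)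
            ENNReal.ofReal_ne_top ?_
          · rw [← ENNReal.ofReal_add (by have := hw0 r; positivity) (by have := hw0 r; positivity),
              ← ofReal_ballFracPerimeter hn hs hs1, ← ofReal_ballVolume, ← hofReal r har,
              ← ENNReal.ofReal_div_of_pos hω,
              ENNReal.ofReal_rpow_of_nonneg (div_nonneg (hw0 r) hω.le) hα0.le,
              ← ENNReal.ofReal_mul hP.le, Real.div_rpow (hw0 r) hω.le, hc]
            congr 1
            ring
          · have h1 := hlt r hr
            have h2 : volume (E \ Metric.ball 0 r) /
                ENNReal.ofReal (C₂ n s * η ^ (s / (n : ℝ))) ≤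
                ENNReal.ofReal (1 - s) * ENNReal.ofReal (c / 2 * w r ^ α) := by
              rw [← hofReal r har, ← ENNReal.ofReal_div_of_pos (by positivity),
                ← ENNReal.ofReal_mul hs1'.le]
              refine ENNReal.ofReal_le_ofReal ?_
              rw [div_le_iff₀ (by positivity), hC₂c]
              have h3 : w r = w r ^ α * w r ^ (s / (n : ℝ)) := by
                rw [← Real.rpow_add_of_nonneg (hw0 r) hα0.le (by positivity), hα,
                  show ((n : ℝ) - s) / n + s / n = 1 by field_simp; ring, Real.rpow_one]
              calc w r = w r ^ α * w r ^ (s / (n : ℝ)) := h3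
                _ ≤ w r ^ α * η ^ (s / (n : ℝ)) := by
                  have := hw0 r
                  have := hwη r har
                  gcongr
                _ = _ := by field_simp
            have h4 := h1.trans_le (add_le_add_right h2 _)
            rw [← mul_add] at h4
            exact lt_of_mul_lt_mul_left' h4
      _ ≤ _ := by
          rw [mul_assoc]
          gcongr
          exact interaction_diff_inter_ball_le hn hs hE r
  have hint : ENNReal.ofReal (c / 2 * w b ^ α) * ENNReal.ofReal (b - a) ≤
      2 * (sphereArea n / ENNReal.ofReal s) *
        (ENNReal.ofReal ((b - a) ^ (1 - s) / (1 - s)) * ENNReal.ofReal (w a)) := by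
    have hne : 2 * (sphereArea n / ENNReal.ofReal s) ≠ ∞ :=
      ENNReal.mul_ne_top ENNReal.ofNat_ne_top
        (ENNReal.div_ne_top (sphereArea_ne_top n) (by simpa using hs))
    calc _ = ∫⁻ _ in Ioo a b, ENNReal.ofReal (c / 2 * w b ^ α) := by
          rw [setLIntegral_const, Real.volume_Ioo]
      _ ≤ ∫⁻ r in Ioo a b, 2 * (sphereArea n / ENNReal.ofReal s) *
          ∫⁻ x in E \ Metric.ball 0 r, ENNReal.ofReal (‖x‖ - r) ^ (-s) :=
          setLIntegral_mono' measurableSet_Ioo hpt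
      _ ≤ _ := by
          rw [lintegral_const_mul' _ _ hne, hofReal a le_rfl]
          gcongr
          exact lintegral_Ioo_lintegral_diff_ball_le hs hs1 hE hab.le
  set ℓ := b - a with hℓ
  have hℓ0 : 0 < ℓ := sub_pos.2 hab
  have hwa := hw0 a
  have hwb := hw0 b
  rw [← ofReal_mul_ballVolume, ← ENNReal.ofReal_div_of_pos hs, ← ENNReal.ofReal_ofNat 2,
    ← ENNReal.ofReal_mul (by positivity), ← ENNReal.ofReal_mul (by positivity),
    ← ENNReal.ofReal_mul (by positivity), ← ENNReal.ofReal_mul (by positivity),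
    ENNReal.ofReal_le_ofReal_iff (by positivity)] at hint
  -- The sphere area from polar coordinates is enlarged to `P(B)`, the quantity appearing in `C₁`.
  have hPer := mul_ballVolume_le_ballPerimeter n
  have hint2 : c / 2 * w b ^ α * ℓ ≤
      2 * (ballPerimeter n / s) * (ℓ ^ (1 - s) / (1 - s) * w a) := by
    refine hint.trans ?_
    gcongr
  rw [Real.rpow_sub hℓ0, Real.rpow_one] at hint2
  have e : c / 2 * (decayConstant n s * ℓ ^ (-s) * w a) * ℓ =
      2 * (ballPerimeter n / s) * (ℓ / ℓ ^ s / (1 - s) * w a) := by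
    rw [decayConstant, ← hα, hc, Real.rpow_neg hℓ0.le]
    field_simp
    ring
  rw [← e] at hint2
  exact le_of_mul_le_mul_left (le_of_mul_le_mul_right hint2 hℓ0) (by positivity)

theorem exists_truncation_radius (hn : 0 < n) {s : ℝ} (hs : 0 < s) (hs1 : s < 1)
    {E : Set (EuclideanSpace ℝ (Fin n))} (hE : MeasurableSet E) {η : ℝ} (hη : 0 ≤ η)
    (hEη : volume (E \ Metric.ball 0 1) ≤ ENNReal.ofReal η) :
    ∃ r : ℝ, 1 ≤ r ∧ r ≤ 1 + C₁ n s * η ^ (1 / (n : ℝ)) ∧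
      ENNReal.ofReal (1 - s) * fracPerimeter s (E ∩ Metric.ball 0 r) +
        volume (E \ Metric.ball 0 r) / ENNReal.ofReal (C₂ n s * η ^ (s / (n : ℝ))) ≤
      ENNReal.ofReal (1 - s) * fracPerimeter s E := by
  have hn1 : (1 : ℝ) ≤ n := by exact_mod_cast hn
  have hC₁ := C₁_pos hn hs hs1
  -- For `η = 0` the quotient has denominator zero and reads `0 / 0 = 0`.
  rcases hη.eq_or_lt with rfl | hη
  · refine ⟨1, le_rfl, ?_, truncation_le_of_volume_diff_eq_zero s (by simpa using hEη) _⟩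
    have : 0 ≤ C₁ n s * (0 : ℝ) ^ (1 / (n : ℝ)) := by positivity
    linarith
  set L := C₁ n s * η ^ (1 / (n : ℝ)) with hL
  have hL0 : 0 < L := by positivity
  by_contra! hcon
  have hD := decayConstant_pos hn hs hs1
  have hLs : L ^ s = 2 ^ (n : ℝ) * decayConstant n s * η ^ (s / (n : ℝ)) := by
    rw [hL, C₁_eq n hs.ne', Real.mul_rpow (by positivity) (by positivity),
      Real.mul_rpow (by positivity) (by positivity), ← Real.rpow_mul (by positivity),
      ← Real.rpow_mul hD.le, ← Real.rpow_mul hη.le, div_mul_cancel₀ _ hs.ne',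
      div_mul_cancel₀ _ hs.ne', Real.rpow_one, one_div_mul_eq_div]
  have htop : ∀ r, 1 ≤ r → volume (E \ Metric.ball 0 r) ≠ ∞ := fun r hr =>
    ne_top_of_le_ne_top ENNReal.ofReal_ne_top ((measure_mono
      (sdiff_subset_sdiff_right (Metric.ball_subset_ball hr))).trans hEη)
  have hzero := eq_zero_of_decay (d := n) hs (by linarith) hD hη hL0 hLs
    -- Below radius one the mass may be infinite and its real value zero; freezing the radius at one
    -- keeps `w` antitone.
    (w := fun r => volume.real (E \ Metric.ball 0 (max r 1))) (fun _ => measureReal_nonneg)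
    (fun r r' hr => measureReal_mono (sdiff_subset_sdiff_right
      (Metric.ball_subset_ball (max_le_max_right 1 hr))) (htop _ (le_max_right _ _)))
    (by rw [max_self]; exact ENNReal.toReal_le_of_le_ofReal hη.le hEη)
    (fun a b ha hab hb => by
      rw [max_eq_left ha, max_eq_left (ha.trans hab.le)]
      refine decay_of_not_truncation hn hs hs1 hE hη ((measure_mono
        (sdiff_subset_sdiff_right (Metric.ball_subset_ball ha))).trans hEη) hab fun r hr => ?_
      exact hcon r (ha.trans hr.1.le) (hr.2.le.trans hb))
  rw [max_eq_left (by linarith), measureReal_eq_zero_iff (htop _ (by linarith))] at hzero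
  exact absurd (hcon (1 + L) (by linarith) le_rfl)
    (not_lt.2 (truncation_le_of_volume_diff_eq_zero s hzero _))

end

end

end FracPerimeter

theorem mainTheorem12 (n : ℕ) (hn : 2 ≤ n) :
    (∀ s : ℝ, 0 < s → s < 1 →
      0 < FracPerimeter.C₁ n s ∧ 0 < FracPerimeter.C₂ n s ∧
      ∀ E : Set (EuclideanSpace ℝ (Fin n)), NullMeasurableSet E volume →
      ∀ η : ℝ, 0 ≤ η → η < 1 →
        volume (E \ FracPerimeter.oball n 1) ≤ ENNReal.ofReal η →
        ∃ r : ℝ, 1 ≤ r ∧ r ≤ 1 + FracPerimeter.C₁ n s * η ^ (1 / (n : ℝ)) ∧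
          ENNReal.ofReal (1 - s) *
                FracPerimeter.fracPerimeter s (E ∩ FracPerimeter.oball n r) +
              volume (E \ FracPerimeter.oball n r) /
                ENNReal.ofReal (FracPerimeter.C₂ n s * η ^ (s / (n : ℝ))) ≤
            ENNReal.ofReal (1 - s) * FracPerimeter.fracPerimeter s E) ∧
    (∀ s₀ : ℝ, 0 < s₀ → s₀ < 1 →
      BddAbove ((fun s : ℝ => FracPerimeter.C₁ n s + FracPerimeter.C₂ n s) '' Ico s₀ 1)) := by
  have hn0 : 0 < n := by omega
  refine ⟨fun s hs hs1 => ⟨FracPerimeter.C₁_pos hn0 hs hs1, FracPerimeter.C₂_pos hn0 hs hs1, ?_⟩,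
    fun s₀ hs₀ _ => FracPerimeter.bddAbove_C₁_add_C₂ hn0 hs₀⟩
  intro E hE η hη _ hEη
  -- A Lebesgue measurable set is replaced by a Borel one equal to it almost everywhere; volumes and
  -- fractional perimeters do not change.
  obtain ⟨F, hF, hEF⟩ := hE
  have hdiff : ∀ r, (E \ Metric.ball 0 r : Set (EuclideanSpace ℝ (Fin n))) =ᵐ[volume]
      (F \ Metric.ball 0 r : Set (EuclideanSpace ℝ (Fin n))) :=
    fun r => hEF.diff Filter.EventuallyEq.rfl
  have hinter : ∀ r, (E ∩ Metric.ball 0 r : Set (EuclideanSpace ℝ (Fin n))) =ᵐ[volume]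
      (F ∩ Metric.ball 0 r : Set (EuclideanSpace ℝ (Fin n))) :=
    fun r => hEF.inter Filter.EventuallyEq.rfl
  simp only [FracPerimeter.oball_eq_ball] at hEη ⊢
  rw [measure_congr (hdiff 1)] at hEη
  obtain ⟨r, h1, h2, h3⟩ := FracPerimeter.exists_truncation_radius hn0 hs hs1 hF hη hEη
  refine ⟨r, h1, h2, ?_⟩
  rwa [measure_congr (hdiff r), FracPerimeter.fracPerimeter_congr_set s (hinter r),
    FracPerimeter.fracPerimeter_congr_set s hEF]
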